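/- Let $n\in\mathbb{N}$, $n\ge 2$, and $\gamma\in\mathbb{R}$ with $(n,\gamma)\ne(2,2)$ and $(n,\gamma)\neq(3,1)$. For $j\in\mathbb{N}_0$ put $\lambda_j=j(j+n-2)$ and $$\alpha_{n,\gamma,\lambda_0}=\frac{(n-\gamma)^2}{4},\qquad \alpha_{n,\gamma,\lambda_j}=\frac{\big[\frac14(n+\gamma-4)(n-\gamma)+\lambda_j\big]^2}{\frac14(n+\gamma-4)^2+\lambda_j}\quad(j\ge 1).$$ Then $A_{n,\gamma}=\min_{j\in\mathbb{N}_0}\alpha_{n,\gamma,\lambda_j}$ exists, and the following hold. (a) For every $R\in(0,\infty)$, with $B=B_n(0;R)$ the open ball of radius $R$ about $0$, $A_{n,\gamma}$ is the sharp constant, that is, the largest real number $C$ such that $$\int_{B}|x|^\gamma|(\Delta f)(x)|^2\,d^nx\ \ge\ C\int_{B}|x|^{\gamma-2}|(\nabla f)(x)|^2\,d^nx\qquad\text{for all complex-valued } f\in C_0^\infty(B\setminus\{0\}).$$ (b) The same is true with $B$ replaced by $\mathbb{R}^n$. (c) Let $R\in(0,\infty)$, let $j_0\in\mathbb{N}_0$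 be such that $\alpha_{n,\gamma,\lambda_{j_0}}=A_{n,\gamma}$, and let $\varphi\not\equiv0$ be a smooth complex-valued function on the unit sphere $\mathbb{S}^{n-1}$ with $-\Delta_{\mathbb{S}^{n-1}}\varphi=\lambda_{j_0}\varphi$. Let $\psi\in C^\infty(\mathbb{R};\mathbb{R})$ satisfy $\psi=0$ on $(-\infty,R/10]$ and on $[9R/10,\infty)$, and $\psi=1$ on $[R/5,4R/5]$. For $\varepsilon\in(0,1)$ let $\psi_\varepsilon(r)=\psi(r/\varepsilon)$ if $r\le\varepsilon R/5$, $\psi_\varepsilon(r)=1$ if $\varepsilon R/5<r\le 4R/5$, and $\psi_\varepsilon(r)=\psi(r)$ if $r>4R/5$. Define, in polar coordinates $x=r\theta$, $$g_\varepsilon(x)=r^{p}\,\psi_\varepsilon(r)\,\varphi(\theta),\qquad p=\tfrac12(4-n-\gamma+\varepsilon).$$ Then, for all sufficiently small $\varepsilon>0$, $g_\varepsilon\in C_0^\infty(B_n(0;R)\setminus\{0\})$ and $\int_{B_n(0;R)}|x|^{\gamma-2}|(\nabla g_\varepsilon)(x)|^2\,d^nx>0$, and $$\lim_{\varepsilon\downarrow0}\frac{\int_{B_n(0;R)}|x|^{\gamma}|(\Delta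 g_\varepsilon)(x)|^2\,d^nx}{\int_{B_n(0;R)}|x|^{\gamma-2}|(\nabla g_\varepsilon)(x)|^2\,d^nx}=\alpha_{n,\gamma,\lambda_{j_0}}.$$ -/

import Mathlib

open MeasureTheory Filter Topology
open scoped ContDiff

noncomputable section

namespace HardyRellich

/-- The Euclidean space of dimension `n`. -/
abbrev Euc (n : ℕ) : Type := EuclideanSpace ℝ (Fin n)

/-- The eigenvalues `j (j + n - 2)` of minus the Laplace-Beltrami operator on the unit sphere. -/
def eigval (n j : ℕ) : ℝ := (j : ℝ) * ((j : ℝ) + (n : ℝ) - 2)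

/-- The numbers whose minimum over `j` is the Hardy-Rellich constant. -/
def alphaCoeff (n : ℕ) (γ : ℝ) (j : ℕ) : ℝ :=
  if j = 0 then ((n : ℝ) - γ) ^ 2 / 4
  else (((n : ℝ) + γ - 4) * ((n : ℝ) - γ) / 4 + eigval n j) ^ 2 /
    (((n : ℝ) + γ - 4) ^ 2 / 4 + eigval n j)

/-- The constant of the weighted Hardy-Rellich inequality. The infimum is over a family of
nonnegative numbers; that it is a minimum is part of the theorem. -/
def constA (n : ℕ) (γ : ℝ) : ℝ := ⨅ j : ℕ, alphaCoeff n γ j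

/-- Complex-valued smooth functions with compact support inside `U`
(extended by zero to the whole space). -/
def IsTestFunction {n : ℕ} (U : Set (Euc n)) (f : Euc n → ℂ) : Prop :=
  ContDiff ℝ ∞ f ∧ HasCompactSupport f ∧ tsupport f ⊆ U

/-- The squared length of the gradient, the sum of the `|∂ᵢ f(x)|²`. -/
def gradSq {n : ℕ} (f : Euc n → ℂ) (x : Euc n) : ℝ :=
  ∑ i : Fin n, ‖fderiv ℝ f x (EuclideanSpace.single i 1)‖ ^ 2

/-- `∫_Ω |x|^γ |Δ f|² dx`. -/
def laplaceEnergy {n : ℕ} (γ : ℝ) (Ω : Set (Euc n)) (f : Euc n → ℂ) : ℝ :=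
  ∫ x in Ω, ‖x‖ ^ γ * ‖Laplacian.laplacian f x‖ ^ 2

/-- `∫_Ω |x|^(γ-2) |∇ f|² dx`. -/
def gradEnergy {n : ℕ} (γ : ℝ) (Ω : Set (Euc n)) (f : Euc n → ℂ) : ℝ :=
  ∫ x in Ω, ‖x‖ ^ (γ - 2) * gradSq f x

/-- The set of all constants `C` for which
`∫_Ω |x|^γ |Δ f|² ≥ C ∫_Ω |x|^(γ-2) |∇ f|²` for all `f ∈ C₀^∞(Ω \ {0})`. -/
def admissibleConstants (n : ℕ) (γ : ℝ) (Ω : Set (Euc n)) : Set ℝ :=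
  {C : ℝ | ∀ f : Euc n → ℂ, IsTestFunction (Ω \ {0}) f →
    C * gradEnergy γ Ω f ≤ laplaceEnergy γ Ω f}

/-- The extension, constant along rays from the origin, of a function on the unit sphere. Only the
values of `φ` on the unit sphere enter (away from the origin). -/
def rayExt {n : ℕ} (φ : Euc n → ℂ) (x : Euc n) : ℂ := φ (‖x‖⁻¹ • x)

/-- `φ` restricted to the unit sphere is a (smooth, nonzero) eigenfunction of minus the
Laplace-Beltrami operator with eigenvalue `μ`. On the unit sphere the Laplace-Beltrami operator
applied to `φ` is the Euclidean Laplacian of the extension of `φ` that is constant along rays. -/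
structure IsSphericalEigenfunction {n : ℕ} (μ : ℝ) (φ : Euc n → ℂ) : Prop where
  smooth : ContDiffOn ℝ ∞ (rayExt φ) {0}ᶜ
  eigen : ∀ x : Euc n, ‖x‖ = 1 → -Laplacian.laplacian (rayExt φ) x = (μ : ℂ) * φ x
  nonzero : ∃ x : Euc n, ‖x‖ = 1 ∧ φ x ≠ 0

/-- A smooth radial profile that vanishes for `r ≤ R/10` and for `r ≥ 9R/10`, and is `1` on
`[R/5, 4R/5]`. -/
structure IsCutoff (R : ℝ) (ψ : ℝ → ℝ) : Prop where
  smooth : ContDiff ℝ ∞ ψ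
  zero_left : ∀ r ≤ R / 10, ψ r = 0
  one_mid : ∀ r ∈ Set.Icc (R / 5) (4 * R / 5), ψ r = 1
  zero_right : ∀ r, 9 * R / 10 ≤ r → ψ r = 0

/-- The profile `ψ_ε`: the left flank of `ψ` is moved to the scale `ε`. -/
def scaledCutoff (R : ℝ) (ψ : ℝ → ℝ) (ε r : ℝ) : ℝ :=
  if r ≤ ε * R / 5 then ψ (r / ε) else if r ≤ 4 * R / 5 then 1 else ψ r

/-- The function `r^p ψ_ε(r) φ(θ)` with `p = (4 - n - γ + ε)/2`, in polar coordinates. -/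
def trialFunction {n : ℕ} (γ R : ℝ) (ψ : ℝ → ℝ) (φ : Euc n → ℂ) (ε : ℝ) (x : Euc n) : ℂ :=
  ((‖x‖ ^ ((4 - (n : ℝ) - γ + ε) / 2) * scaledCutoff R ψ ε ‖x‖ : ℝ) : ℂ) * rayExt φ x

end HardyRellich

end

/-!
The weighted inequality is a statement about two commuting operators on `L²(ℝⁿ, dx)`. In polar
coordinates `r² Δ = E² + (n - 2) E - L`, where `E = r ∂ᵣ` is the Euler operator and `L` is minus the
spherical Laplacian, written without the sphere as `L = -∑_{i<j} (xᵢ ∂ⱼ - xⱼ ∂ᵢ)²`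
(`norm_sq_smul_laplacian`). Substituting `f = r^s u` with `2 s = 4 - γ` removes both weights and
turns `r² Δ` into `(S + a)(S + b) - L`, where `S = E + n / 2` is skew-symmetric,
`a = (4 - n - γ) / 2` and `b = (n - γ) / 2`. Integration by parts gives (`ip_conjLaplacian_self`, `gradEnergy_powMul`)

  `∫ r^γ |Δ f|² = ‖S² u‖² + (a² + b²) ‖S u‖² + 2 ⟨S u, L S u⟩ + ‖(L - a b) u‖²`,
  `∫ r^(γ - 2) |∇ f|² = ‖S u‖² + a² ‖u‖² + ⟨u, L u⟩`.

If `C ≤ b²`, the inequality with constant `C` therefore follows from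
`‖(L - a b) u‖² ≥ C (a² ‖u‖² + ⟨u, L u⟩)`, which is a quadratic inequality in the operator `L`. It
has to be checked on the spectrum of `L` only, and there it says that `C` is at most the numbers
`alphaCoeff n γ j` (`mul_gradEnergy_le_laplaceEnergy`, `constA_mul_le`).

The spectral fact is `quadratic_sphLap_nonneg`. A smooth homogeneous function `f` of degree `d`
satisfies `(L - λ_d) f = - r² Δ f`, and `Δ f` is homogeneous of degree `d - 2`; by induction on `d`
every homogeneous polynomial is a sum of eigenfunctions of `L` with eigenvalues among the
`λ_k = eigval n k`. By the Stone-Weierstrass theorem such sums approximate every test function, and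
eigenfunctions with different eigenvalues, multiplied by a fixed radial cutoff, are orthogonal in
`L²`. So `L` is diagonalized by a Hilbert sum.

For sharpness, the trial function corresponds to `u = r^(-n/2) G(r) φ(θ)` with
`G(r) = r^(ε/2) ψ_ε(r)`, and `S` acts on it as `θ = r d/dr` on `G` while `L` acts as `λ_{j₀}`. The
measure `r^(-n) dx` is invariant under dilations, so the flanks of `ψ_ε` contribute a bounded amount
to `‖S u‖²` and `‖S² u‖²`, while `‖u‖²` diverges as `ε → 0`. Hence the quotient of the energies
tends to `(λ_{j₀} - a b)² / (a² + λ_{j₀})` (`tendsto_trial_quotient`), provided `a² + λ_{j₀} ≠ 0`; at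
a minimizing index this fails only for `(n, γ) = (2, 2)` and `(3, 1)` (`sq_add_eigval_pos`).
-/

namespace HardyRellich

open InnerProductSpace (laplacian_eq_iteratedFDeriv_orthonormalBasis)

variable {n : ℕ}

/-! ### Derivatives along linear vector fields -/

section Operators

variable {F : Type*} [NormedAddCommGroup F] [NormedSpace ℝ F]

/-- The derivative of `f` along the linear vector field `x ↦ A x`. -/
noncomputable def linDeriv (A : Euc n →L[ℝ] Euc n) (f : Euc n → F) (x : Euc n) : F :=
  fderiv ℝ f x (A x)

/-- The Euler operator `∑ xᵢ ∂ᵢ`, which is `r ∂ᵣ` in polar coordinates. -/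
noncomputable def euler (f : Euc n → F) : Euc n → F := linDeriv (.id ℝ _) f

/-- The generator `x ↦ xᵢ eⱼ - xⱼ eᵢ` of the rotations in the `(i, j)`-plane. -/
noncomputable def rot (i j : Fin n) : Euc n →L[ℝ] Euc n :=
  (EuclideanSpace.proj (𝕜 := ℝ) i).smulRight (EuclideanSpace.single j (1 : ℝ)) -
    (EuclideanSpace.proj (𝕜 := ℝ) j).smulRight (EuclideanSpace.single i (1 : ℝ))

/-- Minus the spherical Laplacian, acting on functions on the whole space: `-∑_{i<j} Dᵢⱼ²` with the
angular derivatives `Dᵢⱼ = xᵢ ∂ⱼ - xⱼ ∂ᵢ`. The sum runs over all pairs, which count twice. -/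
noncomputable def sphLap (f : Euc n → F) (x : Euc n) : F :=
  -((1 / 2 : ℝ) • ∑ i, ∑ j, linDeriv (rot i j) (linDeriv (rot i j) f) x)

lemma rot_apply (i j : Fin n) (x : Euc n) :
    rot i j x = x i • EuclideanSpace.single j (1 : ℝ) - x j • EuclideanSpace.single i (1 : ℝ) := by
  simp [rot]

lemma inner_rot_self (i j : Fin n) (x : Euc n) : inner ℝ x (rot i j x) = 0 := by
  simp [rot_apply, inner_sub_right, inner_smul_right, EuclideanSpace.inner_single_right, mul_comm]

section Calculus

variable {A B : Euc n →L[ℝ] Euc n} {f g : Euc n → F} {x : Euc n}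

lemma _root_.ContDiffAt.linDeriv (A : Euc n →L[ℝ] Euc n) (hf : ContDiffAt ℝ ∞ f x) :
    ContDiffAt ℝ ∞ (linDeriv A f) x :=
  (hf.fderiv_right (m := ∞) (by simp)).clm_apply A.contDiff.contDiffAt

lemma _root_.ContDiff.linDeriv (A : Euc n →L[ℝ] Euc n) (hf : ContDiff ℝ ∞ f) :
    ContDiff ℝ ∞ (linDeriv A f) :=
  contDiff_iff_contDiffAt.2 fun _ => hf.contDiffAt.linDeriv A

lemma _root_.ContDiffAt.sphLap (hf : ContDiffAt ℝ ∞ f x) : ContDiffAt ℝ ∞ (sphLap f) x := by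
  unfold HardyRellich.sphLap
  exact (contDiffAt_const.smul (ContDiffAt.sum fun i _ => ContDiffAt.sum fun j _ =>
    (hf.linDeriv _).linDeriv _)).neg

lemma _root_.ContDiff.sphLap (hf : ContDiff ℝ ∞ f) : ContDiff ℝ ∞ (sphLap f) :=
  contDiff_iff_contDiffAt.2 fun _ => hf.contDiffAt.sphLap

lemma eventually_contDiffAt_two (hf : ContDiffAt ℝ ∞ f x) : ∀ᶠ y in 𝓝 x, ContDiffAt ℝ 2 f y :=
  (hf.of_le (m := 2) (by norm_cast)).eventually (by simp)

lemma linDeriv_congr (h : f =ᶠ[𝓝 x] g) : linDeriv A f =ᶠ[𝓝 x] linDeriv A g := by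
  filter_upwards [h.fderiv (𝕜 := ℝ)] with y hy
  simp [linDeriv, hy]

lemma euler_congr (h : f =ᶠ[𝓝 x] g) : euler f =ᶠ[𝓝 x] euler g := linDeriv_congr h

lemma linDeriv_add (hf : DifferentiableAt ℝ f x) (hg : DifferentiableAt ℝ g x) :
    linDeriv A (f + g) x = linDeriv A f x + linDeriv A g x := by
  simp [linDeriv, fderiv_add hf hg]

lemma linDeriv_smul {c : Euc n → ℝ} (hc : DifferentiableAt ℝ c x) (hf : DifferentiableAt ℝ f x) :
    linDeriv A (fun y => c y • f y) x = c x • linDeriv A f x + linDeriv A c x • f x := by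
  simp [linDeriv, fderiv_fun_smul hc hf]

lemma linDeriv_linDeriv (hf : ContDiffAt ℝ 2 f x) :
    linDeriv A (linDeriv B f) x =
      fderiv ℝ (fderiv ℝ f) x (A x) (B x) + fderiv ℝ f x (B (A x)) := by
  have h1 : DifferentiableAt ℝ (fderiv ℝ f) x :=
    (hf.fderiv_right (m := 1) (by norm_num)).differentiableAt (by simp)
  have := (h1.hasFDerivAt.clm_apply B.hasFDerivAt).fderiv
  change fderiv ℝ (fun y => fderiv ℝ f y (B y)) x (A x) = _
  rw [this]
  simp [add_comm]

lemma fderiv_fderiv_symm (hf : ContDiffAt ℝ 2 f x) (v w : Euc n) :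
    fderiv ℝ (fderiv ℝ f) x v w = fderiv ℝ (fderiv ℝ f) x w v :=
  (hf.isSymmSndFDerivAt (by simp [minSmoothness_of_isRCLikeNormedField])).eq v w

lemma euler_linDeriv_comm (hf : ContDiffAt ℝ 2 f x) :
    euler (linDeriv A f) x = linDeriv A (euler f) x := by
  rw [euler, euler, linDeriv_linDeriv hf, linDeriv_linDeriv hf, fderiv_fderiv_symm hf]
  simp

lemma tsupport_linDeriv_subset : tsupport (linDeriv A f) ⊆ tsupport f :=
  (closure_minimal (fun x hx => by
    by_contra h
    exact hx (by simp [linDeriv, fderiv_of_notMem_tsupport ℝ h])) (isClosed_tsupport f))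

lemma sphLap_of_notMem_tsupport (h : x ∉ tsupport f) : sphLap f x = 0 := by
  have : ∀ i j : Fin n, linDeriv (rot i j) (linDeriv (rot i j) f) x = 0 := fun i j =>
    image_eq_zero_of_notMem_tsupport fun h' =>
      h (tsupport_linDeriv_subset (tsupport_linDeriv_subset h'))
  simp [sphLap, this]

lemma tsupport_sphLap_subset : tsupport (sphLap f) ⊆ tsupport f :=
  closure_minimal (fun x hx => by
    by_contra h
    exact hx (sphLap_of_notMem_tsupport h)) (isClosed_tsupport f)

lemma _root_.HasCompactSupport.mono_tsupport {X G G' : Type*} [TopologicalSpace X] [Zero G]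
    [Zero G'] {f : X → G} {g : X → G'} (hf : HasCompactSupport f)
    (h : tsupport g ⊆ tsupport f) : HasCompactSupport g :=
  IsCompact.of_isClosed_subset hf (isClosed_tsupport g) h

lemma sphLap_add (hf : ContDiffAt ℝ ∞ f x) (hg : ContDiffAt ℝ ∞ g x) :
    sphLap (f + g) x = sphLap f x + sphLap g x := by
  have key : ∀ i j : Fin n, linDeriv (rot i j) (linDeriv (rot i j) (f + g)) x =
      linDeriv (rot i j) (linDeriv (rot i j) f) x +
        linDeriv (rot i j) (linDeriv (rot i j) g) x := fun i j => by
    have e : linDeriv (rot i j) (f + g) =ᶠ[𝓝 x] linDeriv (rot i j) f + linDeriv (rot i j) g := by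
      filter_upwards [eventually_contDiffAt_two hf, eventually_contDiffAt_two hg] with y h1 h2
      exact linDeriv_add (h1.differentiableAt (by simp)) (h2.differentiableAt (by simp))
    rw [(linDeriv_congr e).eq_of_nhds]
    exact linDeriv_add ((hf.linDeriv _).differentiableAt (by simp))
      ((hg.linDeriv _).differentiableAt (by simp))
  simp only [sphLap, key, Finset.sum_add_distrib, smul_add, neg_add]

/-- Angular derivatives commute with the Euler operator, hence so does the spherical Laplacian. -/
lemma euler_sphLap_comm (hf : ContDiffAt ℝ ∞ f x) : euler (sphLap f) x = sphLap (euler f) x := by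
  have h2 : ∀ i j : Fin n, ContDiffAt ℝ ∞ (linDeriv (rot i j) (linDeriv (rot i j) f)) x :=
    fun i j => (hf.linDeriv _).linDeriv _
  have key : ∀ i j : Fin n, euler (linDeriv (rot i j) (linDeriv (rot i j) f)) x =
      linDeriv (rot i j) (linDeriv (rot i j) (euler f)) x := fun i j => by
    rw [euler_linDeriv_comm ((hf.linDeriv _).of_le (by norm_cast))]
    refine (linDeriv_congr ?_).eq_of_nhds
    filter_upwards [eventually_contDiffAt_two hf] with y hy using euler_linDeriv_comm hy
  have hd : ∀ i j : Fin n, DifferentiableAt ℝ (linDeriv (rot i j) (linDeriv (rot i j) f)) x :=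
    fun i j => (h2 i j).differentiableAt (by simp)
  have hs : DifferentiableAt ℝ
      (fun y => ∑ i, ∑ j, linDeriv (rot i j) (linDeriv (rot i j) f) y) x :=
    DifferentiableAt.fun_sum fun i _ => DifferentiableAt.fun_sum fun j _ => hd i j
  rw [sphLap, ← Finset.sum_congr rfl fun i _ => Finset.sum_congr rfl fun j _ => key i j]
  change fderiv ℝ (fun y => -((1 / 2 : ℝ) •
    ∑ i, ∑ j, linDeriv (rot i j) (linDeriv (rot i j) f) y)) x x = _
  rw [fderiv_fun_neg, fderiv_fun_const_smul hs, fderiv_fun_sum fun i _ =>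
    DifferentiableAt.fun_sum fun j _ => hd i j]
  simp only [fderiv_fun_sum fun j _ => hd _ j]
  simp [euler, linDeriv]

end Calculus

/-! ### The Laplacian and the gradient in terms of Euler and angular derivatives -/

section Polar

lemma sum_smul_single (x : Euc n) : ∑ i, x i • EuclideanSpace.single i (1 : ℝ) = x := by
  simpa using (EuclideanSpace.basisFun (Fin n) ℝ).sum_repr x

/-- Lagrange's identity for a bilinear map. -/
lemma sum_bilin_rot (H : Euc n →ₗ[ℝ] Euc n →ₗ[ℝ] F) (x : Euc n) :
    ∑ i, ∑ j, H (rot i j x) (rot i j x) =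
      (2 : ℝ) • (‖x‖ ^ 2 • ∑ i, H (EuclideanSpace.single i 1) (EuclideanSpace.single i 1) -
        H x x) := by
  have hx : ‖x‖ ^ 2 = ∑ i, x i * x i := by
    simp [EuclideanSpace.norm_sq_eq, ← sq]
  have h1 : H x x = ∑ i, ∑ j, (x i * x j) •
      H (EuclideanSpace.single i 1) (EuclideanSpace.single j 1) := by
    conv_lhs => rw [← sum_smul_single x]
    simp only [map_sum, LinearMap.sum_apply, map_smul, LinearMap.smul_apply, Finset.smul_sum,
      smul_smul]
    rw [Finset.sum_comm]
    simp only [mul_comm]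
  have h1' : H x x = ∑ i, ∑ j, (x i * x j) •
      H (EuclideanSpace.single j 1) (EuclideanSpace.single i 1) := by
    rw [h1, Finset.sum_comm]
    simp only [mul_comm]
  have h2 : ‖x‖ ^ 2 • ∑ i, H (EuclideanSpace.single i 1) (EuclideanSpace.single i 1) =
      ∑ i, ∑ j, (x i * x i) • H (EuclideanSpace.single j 1) (EuclideanSpace.single j 1) := by
    rw [hx, Finset.sum_smul]
    simp only [Finset.smul_sum]
  have h2' : ‖x‖ ^ 2 • ∑ i, H (EuclideanSpace.single i 1) (EuclideanSpace.single i 1) =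
      ∑ i, ∑ j, (x j * x j) • H (EuclideanSpace.single i 1) (EuclideanSpace.single i 1) := by
    rw [h2, Finset.sum_comm]
  rw [two_smul]
  conv_rhs => enter [1]; rw [h1, h2]
  conv_rhs => enter [2]; rw [h1', h2']
  simp only [← Finset.sum_sub_distrib, ← Finset.sum_add_distrib]
  refine Finset.sum_congr rfl fun i _ => Finset.sum_congr rfl fun j _ => ?_
  simp only [rot_apply, map_sub, map_smul, LinearMap.sub_apply, LinearMap.smul_apply, smul_sub,
    smul_smul, mul_comm (x j) (x i)]
  abel

lemma sum_rot_rot (x : Euc n) :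
    ∑ i, ∑ j, rot i j (rot i j x) = (2 * (1 - n : ℝ)) • x := by
  ext k
  simp only [rot_apply, PiLp.sub_apply, PiLp.smul_apply, PiLp.single_apply, smul_eq_mul,
    WithLp.ofLp_sum, Finset.sum_apply]
  simp [mul_sub, sub_mul, Finset.sum_sub_distrib]
  ring

lemma laplacian_eq_sum_fderiv (f : Euc n → ℂ) (x : Euc n) :
    Laplacian.laplacian f x = ∑ i, fderiv ℝ (fderiv ℝ f) x (EuclideanSpace.single i 1)
      (EuclideanSpace.single i 1) := by
  rw [laplacian_eq_iteratedFDeriv_orthonormalBasis f (EuclideanSpace.basisFun (Fin n) ℝ)]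
  simp [iteratedFDeriv_two_apply]

/-- The Laplacian in polar coordinates: `r² Δ = (r ∂ᵣ)² + (n - 2) r ∂ᵣ + Δ_S`. -/
lemma norm_sq_smul_laplacian {f : Euc n → ℂ} {x : Euc n} (hf : ContDiffAt ℝ ∞ f x) :
    ‖x‖ ^ 2 • Laplacian.laplacian f x =
      euler (euler f) x + ((n : ℝ) - 2) • euler f x - sphLap f x := by
  let H : Euc n →ₗ[ℝ] Euc n →ₗ[ℝ] ℂ := (fderiv ℝ (fderiv ℝ f) x).toLinearMap₁₂
  have h := sum_bilin_rot H x
  have hL : sphLap f x = -((1 / 2 : ℝ) • ((2 : ℝ) • (‖x‖ ^ 2 • Laplacian.laplacian f x -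
      fderiv ℝ (fderiv ℝ f) x x x) + fderiv ℝ f x ((2 * (1 - n : ℝ)) • x))) := by
    rw [sphLap, laplacian_eq_sum_fderiv, ← sum_rot_rot]
    have hf2 : ContDiffAt ℝ 2 f x := hf.of_le (by norm_cast)
    simp only [linDeriv_linDeriv hf2, Finset.sum_add_distrib, map_sum]
    congr 3
  rw [hL, euler, euler, linDeriv_linDeriv (hf.of_le (by norm_cast))]
  simp only [linDeriv, ContinuousLinearMap.id_apply, map_smul, smul_sub, smul_add, smul_smul]
  module

/-- The gradient in polar coordinates. -/
lemma norm_sq_mul_gradSq (f : Euc n → ℂ) (x : Euc n) :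
    ‖x‖ ^ 2 * gradSq f x =
      ‖euler f x‖ ^ 2 + 1 / 2 * ∑ i, ∑ j, ‖linDeriv (rot i j) f x‖ ^ 2 := by
  let H : Euc n →ₗ[ℝ] Euc n →ₗ[ℝ] ℝ :=
    (innerₗ ℂ).compl₁₂ (fderiv ℝ f x).toLinearMap (fderiv ℝ f x).toLinearMap
  have hH : ∀ v, H v v = ‖fderiv ℝ f x v‖ ^ 2 := fun v => by
    simp [H]
  have h := sum_bilin_rot H x
  simp only [hH, smul_eq_mul] at h
  simp only [gradSq, euler, linDeriv, h, ContinuousLinearMap.id_apply]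
  ring

end Polar

end Operators

/-! ### Radial functions -/

section Radial

/-- `g` is smooth at `x` and locally constant along the rotations near `x`. -/
structure IsRadialAt (g : Euc n → ℝ) (x : Euc n) : Prop where
  contDiffAt : ContDiffAt ℝ ∞ g x
  rot_eq_zero : ∀ᶠ y in 𝓝 x, ∀ i j, linDeriv (rot i j) g y = 0

lemma fderiv_comp_norm {G : ℝ → ℝ} {x : Euc n} (hx : x ≠ 0) (hG : DifferentiableAt ℝ G ‖x‖)
    (v : Euc n) : fderiv ℝ (fun y => G ‖y‖) x v = deriv G ‖x‖ * (inner ℝ x v / ‖x‖) := by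
  have h0 : ‖x‖ ≠ 0 := norm_ne_zero_iff.2 hx
  have h1 : HasFDerivAt (fun y : Euc n => ‖y‖) ((1 / (2 * ‖x‖)) • (2 • innerSL ℝ x)) x := by
    have := (hasStrictFDerivAt_norm_sq x).hasFDerivAt.sqrt (by positivity)
    simpa [Real.sqrt_sq] using this
  have := (hG.hasDerivAt.comp_hasFDerivAt x h1).fderiv
  simp only [Function.comp_def] at this
  rw [this]
  simp only [smul_apply, innerSL_apply_apply, smul_eq_mul, nsmul_eq_mul,
    Nat.cast_ofNat]
  field_simp

lemma isRadialAt_comp_norm {G : ℝ → ℝ} {x : Euc n} (hx : x ≠ 0) (hG : ContDiffAt ℝ ∞ G ‖x‖) :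
    IsRadialAt (fun y => G ‖y‖) x where
  contDiffAt := hG.comp x (contDiffAt_norm ℝ hx)
  rot_eq_zero := by
    have h1 : ∀ᶠ t in 𝓝 ‖x‖, ContDiffAt ℝ 1 G t :=
      (hG.of_le (m := 1) (by norm_cast)).eventually (by simp)
    filter_upwards [continuous_norm.continuousAt.eventually h1,
      isOpen_ne.mem_nhds hx] with y hy hy0 i j
    rw [linDeriv, fderiv_comp_norm hy0 (hy.differentiableAt (by simp)), inner_rot_self]
    simp

lemma euler_comp_norm {G : ℝ → ℝ} {x : Euc n} (hx : x ≠ 0) (hG : DifferentiableAt ℝ G ‖x‖) :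
    euler (fun y => G ‖y‖) x = ‖x‖ * deriv G ‖x‖ := by
  rw [euler, linDeriv, fderiv_comp_norm hx hG]
  have h0 : ‖x‖ ≠ 0 := norm_ne_zero_iff.2 hx
  simp
  field_simp

lemma isRadialAt_comp_norm_sq {G : ℝ → ℝ} (hG : ContDiff ℝ ∞ G) (x : Euc n) :
    IsRadialAt (fun y => G (‖y‖ ^ 2)) x where
  contDiffAt := (hG.comp (contDiff_norm_sq ℝ)).contDiffAt
  rot_eq_zero := .of_forall fun y i j => by
    have := ((hG.differentiable (by simp)).differentiableAt.hasDerivAt.comp_hasFDerivAt y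
      (hasStrictFDerivAt_norm_sq y).hasFDerivAt).fderiv
    simp only [Function.comp_def] at this
    rw [linDeriv, this]
    simp [inner_rot_self]

variable {F : Type*} [NormedAddCommGroup F] [NormedSpace ℝ F]

/-- The spherical Laplacian commutes with multiplication by radial functions. -/
lemma sphLap_radial_smul {g : Euc n → ℝ} {f : Euc n → F} {x : Euc n} (hg : IsRadialAt g x)
    (hf : ContDiffAt ℝ ∞ f x) : sphLap (fun y => g y • f y) x = g x • sphLap f x := by
  have key : ∀ i j : Fin n, linDeriv (rot i j) (linDeriv (rot i j) fun y => g y • f y) x =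
      g x • linDeriv (rot i j) (linDeriv (rot i j) f) x := fun i j => by
    have e : linDeriv (rot i j) (fun y => g y • f y) =ᶠ[𝓝 x]
        fun y => g y • linDeriv (rot i j) f y := by
      filter_upwards [eventually_contDiffAt_two hf, eventually_contDiffAt_two hg.contDiffAt,
        hg.rot_eq_zero] with y h1 h2 h3
      rw [linDeriv_smul (h2.differentiableAt (by simp)) (h1.differentiableAt (by simp)), h3]
      simp
    rw [(linDeriv_congr e).eq_of_nhds, linDeriv_smul (hg.contDiffAt.differentiableAt (by simp))
      ((hf.linDeriv _).differentiableAt (by simp)), hg.rot_eq_zero.self_of_nhds]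
    simp
  simp only [sphLap, key, ← Finset.smul_sum, smul_neg]
  rw [smul_comm]

lemma euler_smul {g : Euc n → ℝ} {f : Euc n → F} {x : Euc n} (hg : DifferentiableAt ℝ g x)
    (hf : DifferentiableAt ℝ f x) :
    euler (fun y => g y • f y) x = g x • euler f x + euler g x • f x :=
  linDeriv_smul hg hf

end Radial

/-! ### Test functions and integration by parts -/

section Parts

namespace IsTestFunction

variable {U : Set (Euc n)} {u v : Euc n → ℂ}

lemma linDeriv (hu : IsTestFunction U u) (A : Euc n →L[ℝ] Euc n) :
    IsTestFunction U (linDeriv A u) :=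
  ⟨hu.1.linDeriv A, hu.2.1.mono_tsupport tsupport_linDeriv_subset,
    tsupport_linDeriv_subset.trans hu.2.2⟩

lemma euler (hu : IsTestFunction U u) : IsTestFunction U (euler u) := hu.linDeriv _

lemma sphLap (hu : IsTestFunction U u) : IsTestFunction U (sphLap u) :=
  ⟨hu.1.sphLap, hu.2.1.mono_tsupport tsupport_sphLap_subset,
    tsupport_sphLap_subset.trans hu.2.2⟩

lemma add (hu : IsTestFunction U u) (hv : IsTestFunction U v) : IsTestFunction U (u + v) :=
  ⟨hu.1.add hv.1, hu.2.1.add hv.2.1,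
    (tsupport_add u v).trans (Set.union_subset hu.2.2 hv.2.2)⟩

lemma smul (hu : IsTestFunction U u) (c : ℝ) : IsTestFunction U (c • u) :=
  ⟨hu.1.const_smul c, hu.2.1.mono_tsupport (closure_mono (Function.support_const_smul_subset c u)),
    (closure_mono (Function.support_const_smul_subset c u)).trans hu.2.2⟩

lemma mono {V : Set (Euc n)} (hu : IsTestFunction U u) (h : U ⊆ V) : IsTestFunction V u :=
  ⟨hu.1, hu.2.1, hu.2.2.trans h⟩

lemma memLp (hu : IsTestFunction U u) : MemLp u 2 (volume : Measure (Euc n)) :=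
  hu.1.continuous.memLp_of_hasCompactSupport hu.2.1

/-- The product of a test function off the origin with a function that is smooth off the origin
is smooth. -/
lemma smul_of_contDiffAt {g : Euc n → ℝ} (hu : IsTestFunction U u) (h0 : (0 : Euc n) ∉ U)
    (hg : ∀ x ≠ 0, ContDiffAt ℝ ∞ g x) : IsTestFunction U (fun x => g x • u x) := by
  have hs : tsupport (fun x => g x • u x) ⊆ tsupport u :=
    closure_mono (Function.support_smul_subset_right g u)
  refine ⟨contDiff_iff_contDiffAt.2 fun x => ?_, hu.2.1.mono_tsupport hs, hs.trans hu.2.2⟩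
  by_cases hx : x = 0
  · subst hx
    have : (fun x => g x • u x) =ᶠ[𝓝 0] fun _ => 0 := by
      filter_upwards [(notMem_tsupport_iff_eventuallyEq.1 fun h => h0 (hu.2.2 h))] with y hy
      simp [hy]
    exact contDiffAt_const.congr_of_eventuallyEq this
  · exact (hg x hx).smul hu.1.contDiffAt

end IsTestFunction

/-- The divergence theorem for a linear vector field `x ↦ A x`, whose divergence is the trace of
`A`. -/
lemma integral_linDeriv (A : Euc n →L[ℝ] Euc n) {w : Euc n → ℝ} (hw : ContDiff ℝ 1 w)
    (hc : HasCompactSupport w) :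
    ∫ x, linDeriv A w x = -(∑ i, A (EuclideanSpace.single i 1) i) * ∫ x, w x := by
  have hd : ∀ v, Continuous fun x => fderiv ℝ w x v := fun v =>
    (hw.continuous_fderiv (by simp)).clm_apply continuous_const
  have hdc : ∀ v, HasCompactSupport fun x => fderiv ℝ w x v := fun v =>
    (hc.fderiv (𝕜 := ℝ)).comp_left (g := fun T : Euc n →L[ℝ] ℝ => T v) (by simp)
  have hA : ∀ i, Continuous fun x : Euc n => A x i := fun i => by fun_prop
  have hAd : ∀ i (x : Euc n), HasFDerivAt (fun x : Euc n => A x i)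
      ((EuclideanSpace.proj (𝕜 := ℝ) i).comp A) x := fun i x =>
    ((EuclideanSpace.proj (𝕜 := ℝ) i).comp A).hasFDerivAt
  have h1 : ∀ x, linDeriv A w x = ∑ i, A x i * fderiv ℝ w x (EuclideanSpace.single i 1) := by
    intro x
    conv_lhs => rw [linDeriv, ← sum_smul_single (A x)]
    simp
  have hint : ∀ i, Integrable fun x : Euc n =>
      A x i * fderiv ℝ w x (EuclideanSpace.single i 1) := fun i =>
    ((hA i).mul (hd _)).integrable_of_hasCompactSupport (hdc _).mul_left
  simp only [h1]
  rw [integral_finsetSum _ fun i _ => hint i, neg_mul, Finset.sum_mul, ← Finset.sum_neg_distrib]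
  refine Finset.sum_congr rfl fun i _ => ?_
  have hf : ∀ x : Euc n, fderiv ℝ (fun x : Euc n => A x i) x (EuclideanSpace.single i 1) =
      A (EuclideanSpace.single i 1) i := fun x => by
    rw [(hAd i x).fderiv]; simp
  rw [integral_mul_fderiv_eq_neg_fderiv_mul_of_integrable]
  · simp only [hf, integral_const_mul]
  · simp only [hf]
    exact (hw.continuous.integrable_of_hasCompactSupport hc).const_mul _
  · exact hint i
  · exact ((hA i).mul hw.continuous).integrable_of_hasCompactSupport hc.mul_left
  · exact fun x _ => (hAd i x).differentiableAt
  · exact fun x _ => (hw.differentiable (by simp)).differentiableAt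

/-- The real inner product `Re ∫ u̅ v` of two complex-valued functions. -/
noncomputable def ip (u v : Euc n → ℂ) : ℝ := ∫ x, inner ℝ (u x) (v x)

variable {U : Set (Euc n)} {u v w : Euc n → ℂ}

lemma ip_comm (u v : Euc n → ℂ) : ip u v = ip v u := by
  simp only [ip, real_inner_comm]

lemma integrable_inner (hu : IsTestFunction U u) (hv : Continuous v) :
    Integrable fun x => inner ℝ (u x) (v x) :=
  (hu.1.continuous.inner hv).integrable_of_hasCompactSupport
    (hu.2.1.mono fun x hx h => hx (by simp [h]))

lemma ip_add_right (hu : IsTestFunction U u) (hv : Continuous v) (hw : Continuous w) :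
    ip u (v + w) = ip u v + ip u w := by
  simp only [ip, Pi.add_apply, inner_add_right]
  exact integral_add (integrable_inner hu hv) (integrable_inner hu hw)

lemma ip_smul_right (c : ℝ) (u v : Euc n → ℂ) : ip u (c • v) = c * ip u v := by
  simp only [ip, Pi.smul_apply, inner_smul_right, integral_const_mul]

/-- The formal adjoint of the derivative along `x ↦ A x` is `-D - tr A`. -/
lemma ip_linDeriv (A : Euc n →L[ℝ] Euc n) (hu : IsTestFunction U u) (hv : ContDiff ℝ ∞ v) :
    ip (linDeriv A u) v + ip u (linDeriv A v) =
      -(∑ i, A (EuclideanSpace.single i 1) i) * ip u v := by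
  have h1 : ∀ x, linDeriv A (fun x => inner ℝ (u x) (v x)) x =
      inner ℝ (linDeriv A u x) (v x) + inner ℝ (u x) (linDeriv A v x) := fun x => by
    rw [linDeriv, fderiv_inner_apply ℝ (hu.1.differentiable (by simp)).differentiableAt
      (hv.differentiable (by simp)).differentiableAt]
    simp [linDeriv, add_comm]
  rw [ip, ip, ip, ← integral_linDeriv A ((hu.1.inner ℝ hv).of_le (by norm_cast))
    (hu.2.1.mono fun x hx h => hx (by simp [h])), ← integral_add
    (integrable_inner (hu.linDeriv A) hv.continuous)
    (integrable_inner hu (hv.linDeriv A).continuous)]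
  simp only [h1]

lemma ip_rot (i j : Fin n) (hu : IsTestFunction U u) (hv : ContDiff ℝ ∞ v) :
    ip (linDeriv (rot i j) u) v = -ip u (linDeriv (rot i j) v) := by
  have h : ∑ k, rot i j (EuclideanSpace.single k 1) k = 0 := by
    simp only [rot_apply, PiLp.sub_apply, PiLp.smul_apply, PiLp.single_apply, smul_eq_mul]
    simp [Finset.sum_sub_distrib, eq_comm]
  have := ip_linDeriv (rot i j) hu hv
  rw [h] at this
  linarith

/-- The Dirichlet form of the spherical Laplacian. -/
lemma ip_sphLap_eq (hu : IsTestFunction U u) (hv : ContDiff ℝ ∞ v) :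
    ip u (sphLap v) = 1 / 2 * ∑ i, ∑ j, ip (linDeriv (rot i j) u) (linDeriv (rot i j) v) := by
  have h : ∀ i j, ip (linDeriv (rot i j) u) (linDeriv (rot i j) v) =
      -ip u (linDeriv (rot i j) (linDeriv (rot i j) v)) := fun i j => ip_rot i j hu (hv.linDeriv _)
  simp only [h]
  have hi : ∀ i j, Integrable fun x =>
      inner ℝ (u x) (linDeriv (rot i j) (linDeriv (rot i j) v) x) := fun i j =>
    integrable_inner hu ((hv.linDeriv _).linDeriv _).continuous
  simp only [ip, sphLap, inner_neg_right, inner_smul_right, inner_sum]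
  rw [integral_neg, integral_const_mul, integral_finsetSum _ fun i _ =>
    integrable_finsetSum _ fun j _ => hi i j]
  simp only [integral_finsetSum _ fun j _ => hi _ j, Finset.sum_neg_distrib, mul_neg]

lemma ip_sphLap_self (hu : IsTestFunction U u) :
    ip u (sphLap u) = ∫ x, 1 / 2 * ∑ i, ∑ j, ‖linDeriv (rot i j) u x‖ ^ 2 := by
  rw [ip_sphLap_eq hu hu.1, integral_const_mul]
  have hi : ∀ i j, Integrable fun x => ‖linDeriv (rot i j) u x‖ ^ 2 := fun i j => by
    simpa [real_inner_self_eq_norm_sq] using integrable_inner (hu.linDeriv (rot i j))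
      (hu.linDeriv (rot i j)).1.continuous
  rw [integral_finsetSum _ fun i _ => integrable_finsetSum _ fun j _ => hi i j]
  simp only [integral_finsetSum _ fun j _ => hi _ j, ip, real_inner_self_eq_norm_sq]

lemma ip_sphLap_symm (hu : IsTestFunction U u) (hv : ContDiff ℝ ∞ v) :
    ip (sphLap u) v = ip u (sphLap v) := by
  have h : ∀ i j, ip v (linDeriv (rot i j) (linDeriv (rot i j) u)) =
      -ip (linDeriv (rot i j) u) (linDeriv (rot i j) v) := fun i j => by
    rw [ip_comm, ip_rot i j (hu.linDeriv _) hv]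
  have hi : ∀ i j, Integrable fun x =>
      inner ℝ (v x) (linDeriv (rot i j) (linDeriv (rot i j) u) x) := fun i j => by
    simpa only [real_inner_comm] using
      integrable_inner ((hu.linDeriv (rot i j)).linDeriv (rot i j)) hv.continuous
  rw [ip_sphLap_eq hu hv, ip_comm]
  rw [ip]
  simp only [sphLap, inner_neg_right, inner_smul_right, inner_sum]
  rw [integral_neg, integral_const_mul, integral_finsetSum _ fun i _ =>
    integrable_finsetSum _ fun j _ => hi i j]
  simp only [integral_finsetSum _ fun j _ => hi _ j]
  simp only [ip] at h
  simp only [h, ip, Finset.sum_neg_distrib, mul_neg, neg_neg]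

/-- The Euler operator shifted by `n / 2`, which is skew-symmetric in `L²(ℝⁿ, dx)`. -/
noncomputable def skewEuler (u : Euc n → ℂ) : Euc n → ℂ := euler u + ((n : ℝ) / 2) • u

lemma IsTestFunction.skewEuler (hu : IsTestFunction U u) : IsTestFunction U (skewEuler u) :=
  hu.euler.add (hu.smul _)

lemma ip_skewEuler (hu : IsTestFunction U u) (hv : IsTestFunction U v) :
    ip (skewEuler u) v = -ip u (skewEuler v) := by
  have h := ip_linDeriv (.id ℝ _) hu hv.1
  simp only [ContinuousLinearMap.id_apply, PiLp.single_apply, if_true, Finset.sum_const,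
    Finset.card_univ, Fintype.card_fin, nsmul_eq_mul, mul_one] at h
  rw [skewEuler, skewEuler, ip_comm, ip_add_right hv hu.euler.1.continuous
    (hu.smul _).1.continuous, ip_add_right hu hv.euler.1.continuous (hv.smul _).1.continuous,
    ip_smul_right, ip_smul_right, ip_comm v, ip_comm v]
  simp only [euler]
  linarith

lemma skewEuler_sphLap_comm (hu : IsTestFunction U u) :
    skewEuler (sphLap u) = sphLap (skewEuler u) := by
  ext x
  have hr : IsRadialAt (fun _ : Euc n => (n : ℝ) / 2) x :=
    ⟨contDiffAt_const, .of_forall fun y i j => by simp [linDeriv]⟩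
  have h2 := sphLap_radial_smul hr hu.1.contDiffAt
  simp only [skewEuler]
  rw [sphLap_add hu.euler.1.contDiffAt (hu.smul _).1.contDiffAt, Pi.add_apply,
    euler_sphLap_comm hu.1.contDiffAt]
  congr 1
  exact h2.symm

end Parts

/-! ### Homogeneous functions -/

section Homogeneous

/-- Euler's identity, at a single point and for a real degree. -/
lemma euler_eq_of_homogeneous {f : Euc n → ℂ} {x : Euc n} {d : ℝ} (hf : DifferentiableAt ℝ f x)
    (h : ∀ t : ℝ, 0 < t → f (t • x) = t ^ d • f x) : euler f x = d • f x := by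
  have h1 : HasDerivAt (fun t : ℝ => f (t • x)) (fderiv ℝ f x x) 1 := by
    have hf' : HasFDerivAt f (fderiv ℝ f x) ((1 : ℝ) • x) := by simpa using hf.hasFDerivAt
    simpa using! hf'.comp_hasDerivAt (1 : ℝ) ((hasDerivAt_id (1 : ℝ)).smul_const x)
  have h2 : HasDerivAt (fun t : ℝ => t ^ d • f x) (d • f x) 1 := by
    simpa using (Real.hasDerivAt_rpow_const (x := 1) (p := d) (by simp)).smul_const (f x)
  have h3 : (fun t : ℝ => f (t • x)) =ᶠ[𝓝 1] fun t : ℝ => t ^ d • f x := by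
    filter_upwards [lt_mem_nhds (zero_lt_one' ℝ)] with t ht using h t ht
  exact (h1.congr_of_eventuallyEq h3.symm).unique h2

lemma smul_fderiv_of_comp_smul {E G : Type*} [NormedAddCommGroup E] [NormedSpace ℝ E]
    [NormedAddCommGroup G] [NormedSpace ℝ G] {f g : E → G} {t c : ℝ}
    (h : ∀ x, f (t • x) = c • g x) (x : E) : t • fderiv ℝ f (t • x) = c • fderiv ℝ g x := by
  have h' : (fun x => f (t • x)) = c • g := funext h
  rw [← fderiv_comp_smul (𝕜 := ℝ) (f := f) t, h']
  rw [fderiv_const_smul_field]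
  rfl

lemma laplacian_smul_of_homogeneous {f : Euc n → ℂ} {t c : ℝ} (h : ∀ x, f (t • x) = c • f x)
    (x : Euc n) : t ^ 2 • Laplacian.laplacian f (t • x) = c • Laplacian.laplacian f x := by
  have h2 : t ^ 2 • fderiv ℝ (fderiv ℝ f) (t • x) = c • fderiv ℝ (fderiv ℝ f) x := by
    have h1 : ∀ x, (t • fderiv ℝ f) (t • x) = c • fderiv ℝ f x :=
      smul_fderiv_of_comp_smul h
    have h3 := smul_fderiv_of_comp_smul (f := t • fderiv ℝ f) h1 x
    have h4 : fderiv ℝ (t • fderiv ℝ f) (t • x) = t • fderiv ℝ (fderiv ℝ f) (t • x) :=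
      congrFun (fderiv_const_smul_field (𝕜 := ℝ) (f := fderiv ℝ f) t) (t • x)
    rwa [h4, smul_smul, ← sq] at h3
  simp only [laplacian_eq_sum_fderiv, Finset.smul_sum]
  refine Finset.sum_congr rfl fun i _ => ?_
  have := congr($h2 (EuclideanSpace.single i 1) (EuclideanSpace.single i 1))
  simpa using this

/-- A smooth function on the whole space that is homogeneous of degree `d` (such a function is
a homogeneous polynomial). -/
structure IsHomog (d : ℕ) (f : Euc n → ℂ) : Prop where
  contDiff : ContDiff ℝ ∞ f
  homog : ∀ t : ℝ, 0 < t → ∀ x, f (t • x) = t ^ d • f x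

lemma contDiff_laplacian {f : Euc n → ℂ} (hf : ContDiff ℝ ∞ f) :
    ContDiff ℝ ∞ (Laplacian.laplacian f) := by
  have h : Laplacian.laplacian f = fun x => ∑ i, fderiv ℝ (fderiv ℝ f) x
      (EuclideanSpace.single i 1) (EuclideanSpace.single i 1) :=
    funext (laplacian_eq_sum_fderiv f)
  rw [h]
  have h1 : ContDiff ℝ ∞ (fderiv ℝ (fderiv ℝ f)) :=
    (hf.fderiv_right (m := ∞) (by simp)).fderiv_right (m := ∞) (by simp)
  exact ContDiff.sum fun i _ => (h1.clm_apply contDiff_const).clm_apply contDiff_const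

/-- On homogeneous functions of degree `d` the spherical Laplacian is `eigval n d`, up to a term
of lower degree in the harmonic decomposition. -/
lemma IsHomog.sphLap_eq {d : ℕ} {f : Euc n → ℂ} (hf : IsHomog d f) (x : Euc n) :
    sphLap f x = eigval n d • f x - ‖x‖ ^ 2 • Laplacian.laplacian f x := by
  have h1 : euler f = (d : ℝ) • f := by
    ext x
    exact euler_eq_of_homogeneous (hf.contDiff.differentiable (by simp)).differentiableAt
      fun t ht => by rw [hf.homog t ht, Real.rpow_natCast]
  have h2 : euler (euler f) x = (d : ℝ) • (d : ℝ) • f x := by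
    rw [h1, euler, linDeriv, fderiv_const_smul
      (hf.contDiff.differentiable (by simp)).differentiableAt]
    change (d : ℝ) • euler f x = _
    rw [h1]; rfl
  rw [norm_sq_smul_laplacian hf.contDiff.contDiffAt, h2, h1]
  simp only [eigval, Pi.smul_apply]
  module

lemma IsHomog.laplacian {d : ℕ} {f : Euc n → ℂ} (hf : IsHomog (d + 2) f) :
    IsHomog d (Laplacian.laplacian f) where
  contDiff := contDiff_laplacian hf.contDiff
  homog t ht x := by
    have h := laplacian_smul_of_homogeneous (hf.homog t ht) x
    have h2 : (t ^ 2) ≠ 0 := by positivity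
    rw [pow_add, mul_comm, mul_smul] at h
    exact smul_right_injective _ h2 h

/-- Homogeneity would give the Laplacian a negative degree, so continuity at the origin makes it
vanish. -/
lemma IsHomog.laplacian_eq_zero {d : ℕ} (hd : d < 2) {f : Euc n → ℂ} (hf : IsHomog d f)
    (x : Euc n) : Laplacian.laplacian f x = 0 := by
  have h : ∀ t : ℝ, 0 < t → t ^ (2 - d) • Laplacian.laplacian f (t • x) =
      Laplacian.laplacian f x := fun t ht => by
    have h := laplacian_smul_of_homogeneous (hf.homog t ht) x
    have h2 : t ^ d ≠ 0 := by positivity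
    refine smul_right_injective _ h2 ?_
    simp only
    rw [← h, smul_smul, ← pow_add]
    congr 2
    omega
  have hc : Continuous fun t : ℝ => t ^ (2 - d) • Laplacian.laplacian f (t • x) :=
    (continuous_pow _).smul ((contDiff_laplacian hf.contDiff).continuous.comp
      (continuous_id.smul continuous_const))
  have h1 : Tendsto (fun t : ℝ => t ^ (2 - d) • Laplacian.laplacian f (t • x)) (𝓝[>] 0) (𝓝 0) := by
    have := hc.tendsto 0
    simp only [zero_pow (show 2 - d ≠ 0 by omega), zero_smul] at this
    exact this.mono_left nhdsWithin_le_nhds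
  have h2 : Tendsto (fun t : ℝ => t ^ (2 - d) • Laplacian.laplacian f (t • x)) (𝓝[>] 0)
      (𝓝 (Laplacian.laplacian f x)) :=
    tendsto_const_nhds.congr' (by
      filter_upwards [self_mem_nhdsWithin] with t ht using (h t ht).symm)
  exact tendsto_nhds_unique h2 h1

/-- The smooth eigenfunctions of the spherical Laplacian with eigenvalue `eigval n k`. -/
noncomputable def eigSpace (n k : ℕ) : Submodule ℝ (Euc n → ℂ) where
  carrier := {v | ContDiff ℝ ∞ v ∧ sphLap v = eigval n k • v}
  add_mem' {u v} hu hv := ⟨hu.1.add hv.1, by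
    ext x
    rw [sphLap_add hu.1.contDiffAt hv.1.contDiffAt, hu.2, hv.2, smul_add]; rfl⟩
  zero_mem' := ⟨contDiff_const, by
    ext x
    rw [sphLap_of_notMem_tsupport (by simp)]; simp⟩
  smul_mem' c v hv := ⟨hv.1.const_smul c, by
    ext x
    have := sphLap_radial_smul (g := fun _ => c) (f := v) (x := x)
      ⟨contDiffAt_const, .of_forall fun y i j => by simp [linDeriv]⟩ hv.1.contDiffAt
    change sphLap (fun y => c • v y) x = _
    rw [this, hv.2]
    simp [mul_left_comm]⟩

lemma eigval_strictMono (hn : 2 ≤ n) : StrictMono (eigval n) := fun i j hij => by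
  have h1 : (2 : ℝ) ≤ n := by exact_mod_cast hn
  have h2 : (i : ℝ) < j := by exact_mod_cast hij
  have h3 : (0 : ℝ) ≤ i := by positivity
  simp only [eigval]
  nlinarith

lemma norm_sq_smul_mem_eigSpace {k : ℕ} {v : Euc n → ℂ} (hv : v ∈ eigSpace n k) :
    (fun x => ‖x‖ ^ 2 • v x) ∈ eigSpace n k :=
  ⟨(contDiff_norm_sq ℝ).smul hv.1, by
    ext x
    have := sphLap_radial_smul (isRadialAt_comp_norm_sq contDiff_id x) hv.1.contDiffAt
    simp only [id] at this
    rw [this, hv.2]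
    simp [mul_left_comm]⟩

/-- For `w` a sum of eigenfunctions with eigenvalues other than `eigval n d`, the equation
`(L - eigval n d) w' = r² w` can be solved by a sum of eigenfunctions. -/
lemma exists_sphLap_sub_eq (hn : 2 ≤ n) {d : ℕ} {w : Euc n → ℂ}
    (hw : w ∈ ⨆ k : Fin d, eigSpace n k) :
    ∃ w' ∈ ⨆ k : Fin d, eigSpace n k, ContDiff ℝ ∞ w' ∧
      ∀ x, sphLap w' x = eigval n d • w' x + ‖x‖ ^ 2 • w x := by
  induction hw using Submodule.iSup_induction' with
  | mem k w hw =>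
    have hne : eigval n k - eigval n d ≠ 0 := sub_ne_zero.2 ((eigval_strictMono hn) k.2).ne
    have hm := (eigSpace n k).smul_mem (eigval n k - eigval n d)⁻¹ (norm_sq_smul_mem_eigSpace hw)
    refine ⟨_, Submodule.mem_iSup_of_mem k hm, hm.1, fun x => ?_⟩
    rw [hm.2]
    simp only [Pi.smul_apply, smul_smul]
    rw [← add_smul]
    congr 1
    field_simp
    ring
  | zero => exact ⟨0, zero_mem _, contDiff_const, fun x => by
      rw [sphLap_of_notMem_tsupport (by simp)]; simp⟩
  | add u v _ _ hu hv =>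
    obtain ⟨u', h1, h2, h3⟩ := hu
    obtain ⟨v', h4, h5, h6⟩ := hv
    refine ⟨u' + v', add_mem h1 h4, h2.add h5, fun x => ?_⟩
    rw [sphLap_add h2.contDiffAt h5.contDiffAt, h3, h6]
    simp only [Pi.add_apply, smul_add]
    abel

/-- Homogeneous polynomials are sums of eigenfunctions of the spherical Laplacian. -/
lemma IsHomog.mem_iSup_eigSpace (hn : 2 ≤ n) {d : ℕ} {f : Euc n → ℂ} (hf : IsHomog d f) :
    f ∈ ⨆ k : Fin (d + 1), eigSpace n k := by
  induction d using Nat.strong_induction_on generalizing f with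
  | _ d ih =>
    by_cases hd : d < 2
    · refine Submodule.mem_iSup_of_mem (Fin.last d) ⟨hf.contDiff, ?_⟩
      ext x
      rw [hf.sphLap_eq, hf.laplacian_eq_zero hd]
      simp
    · obtain ⟨e, rfl⟩ : ∃ e, d = e + 2 := ⟨d - 2, by omega⟩
      have h1 : Laplacian.laplacian f ∈ ⨆ k : Fin (e + 2), eigSpace n k := by
        refine (iSup_le fun k => ?_ : ⨆ k : Fin (e + 1), eigSpace n k ≤ _)
          (ih e (by omega) hf.laplacian)
        exact le_iSup (fun k : Fin (e + 2) => eigSpace n k) k.castSucc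
      obtain ⟨w, hw, hws, hwL⟩ := exists_sphLap_sub_eq hn h1
      have h2 : w ∈ ⨆ k : Fin (e + 2 + 1), eigSpace n k := by
        refine (iSup_le fun k => ?_ : ⨆ k : Fin (e + 2), eigSpace n k ≤ _) hw
        exact le_iSup (fun k : Fin (e + 2 + 1) => eigSpace n k) k.castSucc
      -- `w` solves `(L - eigval n d) w = r² Δ f = -(L - eigval n d) f`
      have h3 : f + w ∈ eigSpace n (e + 2) := ⟨hf.contDiff.add hws, by
        ext x
        rw [sphLap_add hf.contDiff.contDiffAt hws.contDiffAt, hf.sphLap_eq, hwL]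
        simp only [Pi.add_apply, Pi.smul_apply, smul_add]
        abel⟩
      have h4 : f + w ∈ ⨆ k : Fin (e + 2 + 1), eigSpace n k :=
        Submodule.mem_iSup_of_mem (Fin.last (e + 2)) h3
      simpa using sub_mem h4 h2

end Homogeneous

/-! ### Density of the eigenfunctions -/

section Density

/-- The multiplicative monoid of homogeneous polynomials. -/
def homogMonoid (n : ℕ) : Submonoid (Euc n → ℂ) where
  carrier := {f | ∃ d, IsHomog d f}
  one_mem' := ⟨0, contDiff_const, fun t ht x => by simp⟩
  mul_mem' := by
    rintro f g ⟨d, hf⟩ ⟨e, hg⟩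
    refine ⟨d + e, hf.contDiff.mul hg.contDiff, fun t ht x => ?_⟩
    simp only [Pi.mul_apply, hf.homog t ht, hg.homog t ht, smul_mul_smul_comm, pow_add]

lemma mem_iSup_eigSpace_of_mem_adjoin (hn : 2 ≤ n) {p : Euc n → ℂ}
    (hp : p ∈ Algebra.adjoin ℝ (homogMonoid n : Set (Euc n → ℂ))) : p ∈ ⨆ k, eigSpace n k := by
  rw [← Subalgebra.mem_toSubmodule, Algebra.adjoin_eq_span, Submonoid.closure_eq] at hp
  refine Submodule.span_le.2 ?_ hp
  rintro f ⟨d, hf⟩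
  exact (iSup_le fun k => le_iSup (fun k => eigSpace n k) (k : ℕ) :
    ⨆ k : Fin (d + 1), eigSpace n k ≤ _) (hf.mem_iSup_eigSpace hn)

/-- Real-valued continuous functions on a ball are uniform limits of polynomials. -/
lemma exists_adjoin_near_real (ρ : ℝ) {g : Euc n → ℝ} (hg : Continuous g) {δ : ℝ} (hδ : 0 < δ) :
    ∃ p ∈ Algebra.adjoin ℝ (homogMonoid n : Set (Euc n → ℂ)),
      ∀ x ∈ Metric.closedBall (0 : Euc n) ρ, ‖(g x : ℂ) - p x‖ < δ := by
  let K := Metric.closedBall (0 : Euc n) ρ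
  have : CompactSpace K := isCompact_iff_compactSpace.1 (isCompact_closedBall _ _)
  let X : Fin n → C(K, ℝ) := fun i => ⟨fun x => (x : Euc n) i, by fun_prop⟩
  let A : Subalgebra ℝ C(K, ℝ) := Algebra.adjoin ℝ (Set.range X)
  have hA : A.SeparatesPoints := by
    intro x y hxy
    obtain ⟨i, hi⟩ : ∃ i, (x : Euc n) i ≠ (y : Euc n) i := by
      by_contra! h
      exact hxy (Subtype.ext (PiLp.ext h))
    exact ⟨X i, ⟨X i, Algebra.subset_adjoin ⟨i, rfl⟩, rfl⟩, hi⟩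
  have hlift : ∀ q ∈ A, ∃ p ∈ Algebra.adjoin ℝ (homogMonoid n : Set (Euc n → ℂ)),
      ∀ x : K, p x = (q x : ℂ) := by
    intro q hq
    induction hq using Algebra.adjoin_induction with
    | mem q hq =>
      obtain ⟨i, rfl⟩ := hq
      refine ⟨fun x => ((x i : ℝ) : ℂ), Algebra.subset_adjoin ⟨1, ?_, fun t ht x => by simp⟩,
        fun x => rfl⟩
      exact Complex.ofRealCLM.contDiff.comp (EuclideanSpace.proj (𝕜 := ℝ) i).contDiff
    | algebraMap r => exact ⟨algebraMap ℝ _ r, Subalgebra.algebraMap_mem _ r, fun x => rfl⟩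
    | add q r _ _ hq hr =>
      obtain ⟨p, hp, hp'⟩ := hq
      obtain ⟨s, hs, hs'⟩ := hr
      exact ⟨p + s, add_mem hp hs, fun x => by simp [hp', hs']⟩
    | mul q r _ _ hq hr =>
      obtain ⟨p, hp, hp'⟩ := hq
      obtain ⟨s, hs, hs'⟩ := hr
      exact ⟨p * s, mul_mem hp hs, fun x => by simp [hp', hs']⟩
  obtain ⟨⟨q, hq⟩, hqn⟩ :=
    ContinuousMap.exists_mem_subalgebra_near_continuousMap_of_separatesPoints A hA
      ⟨fun x : K => g x, by fun_prop⟩ δ hδ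
  obtain ⟨p, hp, hp'⟩ := hlift q hq
  refine ⟨p, hp, fun x hx => ?_⟩
  have h := (ContinuousMap.norm_coe_le_norm _ ⟨x, hx⟩).trans_lt hqn
  have h2 := hp' ⟨x, hx⟩
  simp only at h2
  rw [h2, ← Complex.ofReal_sub, Complex.norm_real, norm_sub_rev]
  exact h

lemma exists_adjoin_near (ρ : ℝ) {g : Euc n → ℂ} (hg : Continuous g) {δ : ℝ} (hδ : 0 < δ) :
    ∃ p ∈ Algebra.adjoin ℝ (homogMonoid n : Set (Euc n → ℂ)),
      ∀ x ∈ Metric.closedBall (0 : Euc n) ρ, ‖g x - p x‖ < δ := by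
  obtain ⟨p, hp, hp'⟩ := exists_adjoin_near_real ρ (Complex.continuous_re.comp hg) (half_pos hδ)
  obtain ⟨q, hq, hq'⟩ := exists_adjoin_near_real ρ (Complex.continuous_im.comp hg) (half_pos hδ)
  have hI : (fun _ => Complex.I : Euc n → ℂ) ∈
      Algebra.adjoin ℝ (homogMonoid n : Set (Euc n → ℂ)) :=
    Algebra.subset_adjoin ⟨0, contDiff_const, fun t ht x => by simp⟩
  refine ⟨p + (fun _ => Complex.I) * q, add_mem hp (mul_mem hI hq), fun x hx => ?_⟩
  have h : g x - (p + (fun _ => Complex.I) * q : Euc n → ℂ) x =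
      (((g x).re : ℂ) - p x) + Complex.I * (((g x).im : ℂ) - q x) := by
    conv_lhs => rw [← Complex.re_add_im (g x)]
    simp only [Pi.add_apply, Pi.mul_apply]
    ring
  rw [h]
  refine (norm_add_le _ _).trans_lt ?_
  have h1 := hp' x hx
  have h2 := hq' x hx
  simp only [Function.comp_apply] at h1 h2
  rw [norm_mul, Complex.norm_I, one_mul]
  linarith

end Density

/-! ### The spectral inequality -/

section Spectral

/-- Here `u` and `w` lie in the closed span of mutually orthogonal subspaces `V k`, and `w` is the
image of `u` under the operator that is `μ k` on `V k`. By Parseval's identity a quadratic form in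
this operator is nonnegative if its symbol is nonnegative at all the `μ k`. -/
lemma quadratic_form_nonneg_of_orthogonal {H : Type*} [NormedAddCommGroup H]
    [InnerProductSpace ℝ H] [CompleteSpace H] (V : ℕ → Submodule ℝ H)
    (hV : ∀ i j, i ≠ j → V i ⟂ V j) (μ : ℕ → ℝ) {u w : H}
    (hu : u ∈ (⨆ k, V k).topologicalClosure) (hw : w ∈ (⨆ k, V k).topologicalClosure)
    (h : ∀ k, ∀ v ∈ V k, inner ℝ v w = μ k * inner ℝ v u) {β c : ℝ}
    (hq : ∀ k, 0 ≤ μ k ^ 2 + β * μ k + c) :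
    0 ≤ inner ℝ w w + β * inner ℝ u w + c * inner ℝ u u := by
  let W : ℕ → Submodule ℝ H := fun k => (V k).topologicalClosure
  have hVW : ∀ k, V k ≤ W k := fun k => (V k).le_topologicalClosure
  have hW : OrthogonalFamily ℝ (fun k => W k) fun k => (W k).subtypeₗᵢ := by
    refine OrthogonalFamily.of_pairwise fun i j hij => ?_
    have h1 : V i ≤ (W j)ᗮ := by
      rw [Submodule.orthogonal_closure]
      exact hV i j hij
    exact (V i).topologicalClosure_minimal h1 (W j).isClosed_orthogonal
  have : ∀ k, CompleteSpace (W k) := fun k =>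
    (V k).isClosed_topologicalClosure.completeSpace_coe
  have hr := hW.range_linearIsometry
  have hsup : (⨆ k, V k).topologicalClosure ≤
      (⨆ i, LinearMap.range ((W i).subtypeₗᵢ).toLinearMap).topologicalClosure := by
    refine Submodule.topologicalClosure_mono (iSup_mono fun i => ?_)
    simpa using hVW i
  obtain ⟨u', rfl⟩ : u ∈ LinearMap.range hW.linearIsometry.toLinearMap := hr ▸ hsup hu
  obtain ⟨w', rfl⟩ : w ∈ LinearMap.range hW.linearIsometry.toLinearMap := hr ▸ hsup hw
  -- compare the components of `u` and `w` in the Hilbert sum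
  have hcoef : ∀ k, w' k = μ k • u' k := by
    intro k
    refine ext_inner_left ℝ fun v => ?_
    have hcl : ∀ v ∈ W k, inner ℝ v (hW.linearIsometry w') =
        μ k * inner ℝ v (hW.linearIsometry u') := by
      intro v hv
      refine closure_minimal (h k) (isClosed_eq ?_ ?_) hv <;> fun_prop
    have := hcl v v.2
    have hs : (v : H) = hW.linearIsometry (lp.single 2 k v) := by
      rw [hW.linearIsometry_apply_single]; rfl
    rw [hs, LinearIsometry.inner_map_map, LinearIsometry.inner_map_map, lp.inner_single_left,
      lp.inner_single_left] at this
    rw [this, inner_smul_right]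
  simp only [LinearIsometry.coe_toLinearMap, LinearIsometry.inner_map_map]
  have h1 := lp.hasSum_inner (𝕜 := ℝ) w' w'
  have h2 := (lp.hasSum_inner (𝕜 := ℝ) u' w').mul_left β
  have h3 := (lp.hasSum_inner (𝕜 := ℝ) u' u').mul_left c
  refine ((h1.add h2).add h3).nonneg fun k => ?_
  rw [hcoef k]
  simp only [inner_smul_left, inner_smul_right, real_inner_self_eq_norm_sq]
  have := mul_nonneg (hq k) (sq_nonneg ‖u' k‖)
  simp only [conj_trivial]
  linarith

/-- A quadratic polynomial in the spherical Laplacian `L` that is nonnegative at all eigenvalues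
`eigval n k` is a nonnegative operator. -/
lemma quadratic_sphLap_nonneg (hn : 2 ≤ n) {U : Set (Euc n)} {u : Euc n → ℂ}
    (hu : IsTestFunction U u) {β c : ℝ} (hq : ∀ k, 0 ≤ eigval n k ^ 2 + β * eigval n k + c) :
    0 ≤ ip (sphLap u) (sphLap u) + β * ip u (sphLap u) + c * ip u u := by
  obtain ⟨ρ, hρ0, hρ⟩ : ∃ ρ : ℝ, 0 < ρ ∧ tsupport u ⊆ Metric.closedBall 0 ρ :=
    (hu.2.1.isBounded.subset_closedBall_lt 0 0)
  -- a radial cutoff function equal to `1` on the support of `u`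
  let χ : Euc n → ℝ := fun x => Real.smoothTransition (ρ ^ 2 + 1 - ‖x‖ ^ 2)
  have hG : ContDiff ℝ ∞ fun t : ℝ => Real.smoothTransition (ρ ^ 2 + 1 - t) :=
    Real.smoothTransition.contDiff.comp (contDiff_const.sub contDiff_id)
  have hχr : ∀ x, IsRadialAt χ x := isRadialAt_comp_norm_sq hG
  have hχs : ContDiff ℝ ∞ χ := contDiff_iff_contDiffAt.2 fun x => (hχr x).contDiffAt
  have hχ0 : ∀ x, x ∉ Metric.closedBall (0 : Euc n) (ρ + 1) → χ x = 0 := fun x hx => by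
    rw [mem_closedBall_zero_iff, not_le] at hx
    exact Real.smoothTransition.zero_of_nonpos (by nlinarith)
  have hχ1 : ∀ x ∈ tsupport u, χ x = 1 := fun x hx => by
    have := mem_closedBall_zero_iff.1 (hρ hx)
    exact Real.smoothTransition.one_of_one_le (by nlinarith [norm_nonneg x])
  have hχc : HasCompactSupport χ :=
    HasCompactSupport.intro (isCompact_closedBall _ _) hχ0
  have hχT : ∀ v : Euc n → ℂ, ContDiff ℝ ∞ v →
      IsTestFunction Set.univ fun x => χ x • v x := fun v hv =>
    ⟨hχs.smul hv, hχc.smul_right, Set.subset_univ _⟩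
  have hχp : MemLp χ 2 (volume : Measure (Euc n)) :=
    hχs.continuous.memLp_of_hasCompactSupport hχc
  -- the eigenfunctions, cut off by `χ` so as to lie in `L²`
  let V : ℕ → Submodule ℝ (Lp ℂ 2 (volume : Measure (Euc n))) := fun k =>
    { carrier := {z | ∃ v ∈ eigSpace n k, z =ᵐ[volume] fun x => χ x • v x}
      add_mem' := by
        rintro z z' ⟨v, hv, hz⟩ ⟨v', hv', hz'⟩
        refine ⟨v + v', add_mem hv hv', ?_⟩
        filter_upwards [hz, hz', Lp.coeFn_add z z'] with x h1 h2 h3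
        simp only [h3, Pi.add_apply, h1, h2, smul_add]
      zero_mem' := ⟨0, zero_mem _, by
        filter_upwards [Lp.coeFn_zero ℂ 2 (volume : Measure (Euc n))] with x
        simp⟩
      smul_mem' := by
        rintro c z ⟨v, hv, hz⟩
        refine ⟨c • v, (eigSpace n k).smul_mem c hv, ?_⟩
        filter_upwards [hz, Lp.coeFn_smul c z] with x h1 h2
        rw [h2, Pi.smul_apply, h1]
        exact smul_comm _ _ _ }
  have hinner : ∀ (z z' : Lp ℂ 2 (volume : Measure (Euc n))) (v v' : Euc n → ℂ),
      z =ᵐ[volume] v → z' =ᵐ[volume] v' → inner ℝ z z' = ip v v' := by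
    intro z z' v v' h h'
    rw [L2.inner_def, ip]
    refine integral_congr_ae ?_
    filter_upwards [h, h'] with x h1 h2
    rw [h1, h2]
  have hLχ : ∀ k, ∀ v ∈ eigSpace n k, sphLap (fun x => χ x • v x) =
      eigval n k • fun x => χ x • v x := fun k v hv => by
    ext x
    rw [sphLap_radial_smul (hχr x) hv.1.contDiffAt, hv.2]
    exact smul_comm (χ x) (eigval n k) (v x)
  -- `χ` is radial, so cutting off keeps eigenfunctions and their orthogonality
  have hVo : ∀ i j, i ≠ j → V i ⟂ V j := by
    intro i j hij
    rw [Submodule.isOrtho_iff_inner_eq]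
    rintro z ⟨v, hv, hz⟩ z' ⟨v', hv', hz'⟩
    rw [hinner z z' _ _ hz hz']
    have h := ip_sphLap_symm (hχT v hv.1) (hχT v' hv'.1).1
    rw [hLχ i v hv, hLχ j v' hv', ip_comm, ip_smul_right, ip_smul_right, ip_comm] at h
    have hne : eigval n i ≠ eigval n j := (eigval_strictMono hn).injective.ne hij
    by_contra h0
    exact hne (mul_right_cancel₀ h0 h)
  -- a polynomial uniformly close to `w` on the support of `χ` is, after the cutoff, `L²`-close to
  -- `w = χ w`
  have hdense : ∀ (w : Euc n → ℂ) (hw : IsTestFunction U w), tsupport w ⊆ tsupport u →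
      hw.memLp.toLp w ∈ (⨆ k, V k).topologicalClosure := by
    intro w hw hwu
    refine Metric.mem_closure_iff.2 fun ε hε => ?_
    have hM : 0 < ‖hχp.toLp χ‖ + 1 := by positivity
    obtain ⟨p, hp, hpn⟩ := exists_adjoin_near (ρ + 1) hw.1.continuous (div_pos hε hM)
    have hlift : ∀ p ∈ ⨆ k, eigSpace n k, ∃ z ∈ ⨆ k, V k, z =ᵐ[volume] fun x => χ x • p x := by
      intro p hp
      induction hp using Submodule.iSup_induction' with
      | mem k v hv =>
        exact ⟨(hχT v hv.1).memLp.toLp _, Submodule.mem_iSup_of_mem k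
          ⟨v, hv, (hχT v hv.1).memLp.coeFn_toLp⟩, (hχT v hv.1).memLp.coeFn_toLp⟩
      | zero => exact ⟨0, zero_mem _, by
          filter_upwards [Lp.coeFn_zero ℂ 2 (volume : Measure (Euc n))] with x
          simp⟩
      | add v v' _ _ hv hv' =>
        obtain ⟨z, hz, hz2⟩ := hv
        obtain ⟨z', hz', hz2'⟩ := hv'
        refine ⟨z + z', add_mem hz hz', ?_⟩
        filter_upwards [hz2, hz2', Lp.coeFn_add z z'] with x h1 h2 h3
        simp only [h3, Pi.add_apply, h1, h2, smul_add]
    obtain ⟨z, hz, hzp⟩ := hlift p (mem_iSup_eigSpace_of_mem_adjoin hn hp)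
    refine ⟨z, hz, ?_⟩
    have hbound : ‖hw.memLp.toLp w - z‖ ≤ ε / (‖hχp.toLp χ‖ + 1) * ‖hχp.toLp χ‖ := by
      refine Lp.norm_le_mul_norm_of_ae_le_mul ?_
      filter_upwards [hzp, hw.memLp.coeFn_toLp, hχp.coeFn_toLp,
        Lp.coeFn_sub (hw.memLp.toLp w) z] with x h1 h2 h3 h4
      rw [h4, Pi.sub_apply, h1, h2, h3]
      have hχw : w x = χ x • w x := by
        by_cases hx : x ∈ tsupport w
        · rw [hχ1 x (hwu hx), one_smul]
        · simp [image_eq_zero_of_notMem_tsupport hx]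
      rw [hχw, ← smul_sub, norm_smul, mul_comm]
      by_cases hx : x ∈ Metric.closedBall (0 : Euc n) (ρ + 1)
      · exact mul_le_mul_of_nonneg_right (hpn x hx).le (norm_nonneg _)
      · simp [hχ0 x hx]
    rw [dist_eq_norm]
    refine hbound.trans_lt ?_
    rw [div_mul_eq_mul_div, div_lt_iff₀ hM]
    nlinarith
  have hu1 := hu.memLp.coeFn_toLp
  have hu2 := hu.sphLap.memLp.coeFn_toLp
  have heig : ∀ k, ∀ z ∈ V k, inner ℝ z (hu.sphLap.memLp.toLp _) =
      eigval n k * inner ℝ z (hu.memLp.toLp _) := by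
    rintro k z ⟨v, hv, hz⟩
    rw [hinner _ _ _ _ hz hu2, hinner _ _ _ _ hz hu1,
      ← ip_sphLap_symm (hχT v hv.1) hu.1, hLχ k v hv, ip_comm, ip_smul_right, ip_comm]
  have := quadratic_form_nonneg_of_orthogonal V hVo (eigval n) (hdense u hu subset_rfl)
    (hdense _ hu.sphLap tsupport_sphLap_subset) heig hq
  rwa [hinner _ _ _ _ hu2 hu2, hinner _ _ _ _ hu1 hu2, hinner _ _ _ _ hu1 hu1] at this

end Spectral

/-! ### The energies as quadratic forms -/

section Energies

variable {U Ω : Set (Euc n)} {u : Euc n → ℂ} {s : ℝ}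

/-- The function `r^s u`. -/
noncomputable def powMul (s : ℝ) (u : Euc n → ℂ) (x : Euc n) : ℂ := ‖x‖ ^ s • u x

lemma contDiffAt_rpow_of_pos (s : ℝ) {t : ℝ} (ht : 0 < t) : ContDiffAt ℝ ∞ (fun t : ℝ => t ^ s) t :=
  Real.contDiffAt_rpow_const_of_ne ht.ne'

lemma contDiffAt_norm_rpow (s : ℝ) {x : Euc n} (hx : x ≠ 0) :
    ContDiffAt ℝ ∞ (fun y : Euc n => ‖y‖ ^ s) x :=
  (isRadialAt_comp_norm hx (contDiffAt_rpow_of_pos s (norm_pos_iff.2 hx))).contDiffAt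

lemma IsTestFunction.powMul (hu : IsTestFunction U u) (h0 : (0 : Euc n) ∉ U) (s : ℝ) :
    IsTestFunction U (powMul s u) :=
  hu.smul_of_contDiffAt h0 fun _ hx => contDiffAt_norm_rpow s hx

lemma euler_powMul {x : Euc n} (hx : x ≠ 0) (hu : DifferentiableAt ℝ u x) :
    euler (powMul s u) x = powMul s (euler u + s • u) x := by
  have hp : 0 < ‖x‖ := norm_pos_iff.2 hx
  have h1 : euler (fun y : Euc n => ‖y‖ ^ s) x = s * ‖x‖ ^ s := by
    rw [euler_comp_norm (G := fun t => t ^ s) hx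
      ((contDiffAt_rpow_of_pos s hp).differentiableAt (by simp)), Real.deriv_rpow_const,
      Real.rpow_sub_one hp.ne']
    field_simp
  have := euler_smul ((contDiffAt_norm_rpow s hx).differentiableAt (by simp)) hu
  rw [h1] at this
  change euler (fun y => ‖y‖ ^ s • u y) x = ‖x‖ ^ s • (euler u x + s • u x)
  rw [this]
  module

lemma linDeriv_rot_powMul {x : Euc n} (hx : x ≠ 0) (hu : DifferentiableAt ℝ u x) (i j : Fin n) :
    linDeriv (rot i j) (powMul s u) x = ‖x‖ ^ s • linDeriv (rot i j) u x := by
  have hr := isRadialAt_comp_norm hx (contDiffAt_rpow_of_pos s (norm_pos_iff.2 hx))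
  have := linDeriv_smul (A := rot i j) (hr.contDiffAt.differentiableAt (by simp)) hu
  rw [hr.rot_eq_zero.self_of_nhds i j, zero_smul, add_zero] at this
  exact this

lemma euler_add_smul {v : Euc n → ℂ} (hu : IsTestFunction U u) (hv : IsTestFunction U v) (c : ℝ) :
    euler (u + c • v) = euler u + c • euler v := by
  ext x
  have hv' : DifferentiableAt ℝ v x := (hv.1.differentiable (by simp)).differentiableAt
  rw [euler, linDeriv_add (hu.1.differentiable (by simp)).differentiableAt (hv'.const_smul c)]
  congr 1
  rw [linDeriv, fderiv_const_smul hv']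
  rfl

/-- The operator `r² Δ` conjugated with `r^s`, where `2 s = 4 - γ`; it acts on `L²(ℝⁿ, dx)`. -/
noncomputable def conjLaplacian (a b : ℝ) (u : Euc n → ℂ) : Euc n → ℂ :=
  skewEuler (skewEuler u) + (a + b) • skewEuler u + (a * b) • u + (-1 : ℝ) • sphLap u

lemma IsTestFunction.conjLaplacian (hu : IsTestFunction U u) (a b : ℝ) :
    IsTestFunction U (conjLaplacian a b u) :=
  ((hu.skewEuler.skewEuler.add (hu.skewEuler.smul _)).add (hu.smul _)).add (hu.sphLap.smul _)

lemma norm_sq_smul_laplacian_powMul (hu : IsTestFunction U u) {x : Euc n} (hx : x ≠ 0) :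
    ‖x‖ ^ 2 • Laplacian.laplacian (powMul s u) x =
      ‖x‖ ^ s • conjLaplacian (s - n / 2) (s + n / 2 - 2) u x := by
  have hr := isRadialAt_comp_norm hx (contDiffAt_rpow_of_pos s (norm_pos_iff.2 hx))
  have hs : ContDiffAt ℝ ∞ (powMul s u) x := hr.contDiffAt.smul hu.1.contDiffAt
  have hd : ∀ {v : Euc n → ℂ}, IsTestFunction U v → ∀ y, DifferentiableAt ℝ v y := fun hv y =>
    (hv.1.differentiable (by simp)).differentiableAt
  have hv := hu.euler.add (hu.smul s)
  have h1 : euler (powMul s u) =ᶠ[𝓝 x] powMul s (euler u + s • u) := by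
    filter_upwards [isOpen_ne.mem_nhds hx] with y hy using euler_powMul hy (hd hu y)
  rw [norm_sq_smul_laplacian hs, (euler_congr h1).eq_of_nhds, h1.eq_of_nhds,
    euler_powMul hx (hd hv x), euler_add_smul hu.euler hu]
  have h2 : sphLap (powMul s u) x = ‖x‖ ^ s • sphLap u x := sphLap_radial_smul hr hu.1.contDiffAt
  rw [h2]
  simp only [conjLaplacian, skewEuler, euler_add_smul hu.euler hu, powMul, Pi.add_apply,
    Pi.smul_apply]
  module

lemma rpow_mul_sq_eq {γ : ℝ} (hs : 2 * s = 4 - γ) {r : ℝ} (hr : 0 < r) :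
    r ^ γ * (r ^ s) ^ 2 = r ^ 4 := by
  rw [← Real.rpow_natCast (r ^ s), ← Real.rpow_mul hr.le, ← Real.rpow_add hr, ← Real.rpow_natCast]
  congr 1
  push_cast
  linarith

lemma tsupport_powMul_subset : tsupport (powMul s u) ⊆ tsupport u :=
  closure_mono (Function.support_smul_subset_right (fun x : Euc n => ‖x‖ ^ s) u)

/-- The power `s` is chosen so that all weights cancel. Near the origin both integrands vanish, so
the value of `0 ^ s` does not matter. -/
lemma laplaceEnergy_powMul {γ : ℝ} (hs : 2 * s = 4 - γ) (hu : IsTestFunction U u)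
    (h0 : (0 : Euc n) ∉ U) (hU : U ⊆ Ω) :
    laplaceEnergy γ Ω (powMul s u) =
      ip (conjLaplacian (s - n / 2) (s + n / 2 - 2) u)
        (conjLaplacian (s - n / 2) (s + n / 2 - 2) u) := by
  have hT := hu.conjLaplacian (s - n / 2) (s + n / 2 - 2)
  have hpt : ∀ x, ‖x‖ ^ γ * ‖Laplacian.laplacian (powMul s u) x‖ ^ 2 =
      ‖conjLaplacian (s - n / 2) (s + n / 2 - 2) u x‖ ^ 2 := by
    intro x
    by_cases hx : x ∈ tsupport u
    · have hx0 : x ≠ 0 := fun h => h0 (h ▸ hu.2.2 hx)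
      have hr : 0 < ‖x‖ := norm_pos_iff.2 hx0
      have h := congr(‖$(norm_sq_smul_laplacian_powMul (s := s) hu hx0)‖ ^ 2)
      rw [norm_smul, norm_smul, mul_pow, mul_pow, Real.norm_of_nonneg (by positivity),
        Real.norm_of_nonneg (by positivity)] at h
      have h4 : ‖x‖ ^ 4 ≠ 0 := by positivity
      refine mul_left_cancel₀ h4 ?_
      calc ‖x‖ ^ 4 * (‖x‖ ^ γ * ‖Laplacian.laplacian (powMul s u) x‖ ^ 2)
          = ‖x‖ ^ γ * ((‖x‖ ^ 2) ^ 2 * ‖Laplacian.laplacian (powMul s u) x‖ ^ 2) := by ring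
        _ = _ := by rw [h, ← mul_assoc, rpow_mul_sq_eq hs hr]
    · have h1 : powMul s u =ᶠ[𝓝 x] fun _ => 0 :=
        notMem_tsupport_iff_eventuallyEq.1 fun h => hx (tsupport_powMul_subset h)
      have h2 : Laplacian.laplacian (powMul s u) x = 0 := by
        rw [(InnerProductSpace.laplacian_congr_nhds h1).eq_of_nhds]
        simp
      have h3 : conjLaplacian (s - n / 2) (s + n / 2 - 2) u x = 0 := by
        have hU' : IsTestFunction (tsupport u) u := ⟨hu.1, hu.2.1, subset_rfl⟩
        exact image_eq_zero_of_notMem_tsupport fun h => hx ((hU'.conjLaplacian _ _).2.2 h)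
      simp [h2, h3]
  rw [laplaceEnergy, ip]
  simp only [hpt, real_inner_self_eq_norm_sq]
  refine setIntegral_eq_integral_of_forall_compl_eq_zero fun x hx => ?_
  rw [image_eq_zero_of_notMem_tsupport fun h => hx (hU (hT.2.2 h))]
  simp

lemma gradEnergy_powMul {γ : ℝ} (hs : 2 * s = 4 - γ) (hu : IsTestFunction U u)
    (h0 : (0 : Euc n) ∉ U) (hU : U ⊆ Ω) :
    gradEnergy γ Ω (powMul s u) =
      ip (skewEuler u + (s - n / 2) • u) (skewEuler u + (s - n / 2) • u) + ip u (sphLap u) := by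
  have hv := hu.skewEuler.add (hu.smul (s - n / 2))
  have hd : ∀ y, DifferentiableAt ℝ u y := fun y =>
    (hu.1.differentiable (by simp)).differentiableAt
  have hpt : ∀ x, ‖x‖ ^ (γ - 2) * gradSq (powMul s u) x =
      ‖(skewEuler u + (s - n / 2) • u) x‖ ^ 2 +
        1 / 2 * ∑ i, ∑ j, ‖linDeriv (rot i j) u x‖ ^ 2 := by
    intro x
    by_cases hx : x ∈ tsupport u
    · have hx0 : x ≠ 0 := fun h => h0 (h ▸ hu.2.2 hx)
      have hr : 0 < ‖x‖ := norm_pos_iff.2 hx0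
      have h := norm_sq_mul_gradSq (powMul s u) x
      have hE : (skewEuler u + (s - n / 2) • u) x = (euler u + s • u) x := by
        simp only [skewEuler, Pi.add_apply, Pi.smul_apply]
        module
      rw [euler_powMul hx0 (hd x), powMul, norm_smul, mul_pow,
        Real.norm_of_nonneg (by positivity)] at h
      simp only [linDeriv_rot_powMul hx0 (hd x), norm_smul, mul_pow,
        Real.norm_of_nonneg (Real.rpow_nonneg hr.le s), ← Finset.mul_sum] at h
      have h4 : ‖x‖ ^ 4 ≠ 0 := by positivity
      refine mul_left_cancel₀ h4 ?_
      have h5 : ‖x‖ ^ (γ - 2) = ‖x‖ ^ γ / ‖x‖ ^ 2 := by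
        rw [Real.rpow_sub hr]; norm_num
      rw [hE, h5]
      calc ‖x‖ ^ 4 * (‖x‖ ^ γ / ‖x‖ ^ 2 * gradSq (powMul s u) x)
          = ‖x‖ ^ γ * (‖x‖ ^ 2 * gradSq (powMul s u) x) := by field_simp
        _ = (‖x‖ ^ γ * (‖x‖ ^ s) ^ 2) * (‖(euler u + s • u) x‖ ^ 2 +
              1 / 2 * ∑ i, ∑ j, ‖linDeriv (rot i j) u x‖ ^ 2) := by rw [h]; ring
        _ = _ := by rw [rpow_mul_sq_eq hs hr]
    · have h1 : fderiv ℝ (powMul s u) x = 0 :=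
        fderiv_of_notMem_tsupport ℝ fun h => hx (tsupport_powMul_subset h)
      have h2 : fderiv ℝ u x = 0 := fderiv_of_notMem_tsupport ℝ hx
      have h3 : u x = 0 := image_eq_zero_of_notMem_tsupport hx
      simp [gradSq, h1, skewEuler, euler, linDeriv, h2, h3]
  have hi : ∀ i j, Integrable fun x => ‖linDeriv (rot i j) u x‖ ^ 2 := fun i j => by
    simpa [real_inner_self_eq_norm_sq] using integrable_inner (hu.linDeriv (rot i j))
      (hu.linDeriv (rot i j)).1.continuous
  rw [gradEnergy, ip_sphLap_self hu, ip, ← integral_add (integrable_inner hv hv.1.continuous)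
    ((integrable_finsetSum _ fun i _ => integrable_finsetSum _ fun j _ => hi i j).const_mul _)]
  simp only [hpt, real_inner_self_eq_norm_sq]
  refine setIntegral_eq_integral_of_forall_compl_eq_zero fun x hx => ?_
  have hx' : x ∉ tsupport u := fun h => hx (hU (hu.2.2 h))
  have h2 : fderiv ℝ u x = 0 := fderiv_of_notMem_tsupport ℝ hx'
  have h3 : u x = 0 := image_eq_zero_of_notMem_tsupport hx'
  simp [skewEuler, euler, linDeriv, h2, h3]

/-- The form `ip` is the inner product of `L²`, whose bilinearity is used for expansions. -/
lemma ip_eq_inner {v : Euc n → ℂ} (hu : IsTestFunction U u) (hv : IsTestFunction U v) :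
    ip u v = inner ℝ (hu.memLp.toLp u) (hv.memLp.toLp v) := by
  rw [L2.inner_def, ip]
  refine integral_congr_ae ?_
  filter_upwards [hu.memLp.coeFn_toLp, hv.memLp.coeFn_toLp] with x h1 h2
  rw [h1, h2]

lemma ip_skewEuler_self (hu : IsTestFunction U u) : ip (skewEuler u) u = 0 := by
  have h1 := ip_skewEuler hu hu
  rw [ip_comm u] at h1
  linarith

lemma ip_skewEuler_sphLap (hu : IsTestFunction U u) : ip (skewEuler u) (sphLap u) = 0 := by
  have h1 := ip_skewEuler hu hu.sphLap
  rw [skewEuler_sphLap_comm hu, ← ip_sphLap_symm hu hu.skewEuler.1, ip_comm (sphLap u)] at h1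
  linarith

/-- All cross terms between skew-symmetric and symmetric parts drop out. -/
lemma ip_conjLaplacian_self (hu : IsTestFunction U u) (a b : ℝ) :
    ip (conjLaplacian a b u) (conjLaplacian a b u) =
      ip (skewEuler (skewEuler u)) (skewEuler (skewEuler u)) +
        (a ^ 2 + b ^ 2) * ip (skewEuler u) (skewEuler u) +
        2 * ip (skewEuler u) (sphLap (skewEuler u)) +
        (ip (sphLap u) (sphLap u) - 2 * (a * b) * ip u (sphLap u) + (a * b) ^ 2 * ip u u) := by
  have he := hu.skewEuler
  have hee := he.skewEuler
  have hl := hu.sphLap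
  have r1 := ip_skewEuler_self hu
  have r2 := ip_skewEuler_self he
  have r3 := ip_skewEuler_sphLap hu
  have r4 := ip_skewEuler he hu
  have r5 := ip_skewEuler he hl
  rw [skewEuler_sphLap_comm hu] at r5
  have hT : (hu.conjLaplacian a b).memLp.toLp _ =
      hee.memLp.toLp _ + (a + b) • he.memLp.toLp _ + (a * b) • hu.memLp.toLp _ +
        (-1 : ℝ) • hl.memLp.toLp _ := rfl
  rw [ip_eq_inner (hu.conjLaplacian a b) (hu.conjLaplacian a b), hT]
  rw [ip_eq_inner he hu] at r1
  rw [ip_eq_inner hee he] at r2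
  rw [ip_eq_inner he hl] at r3
  rw [ip_eq_inner hee hu, ip_eq_inner he he] at r4
  rw [ip_eq_inner hee hl] at r5
  rw [ip_eq_inner hee hee, ip_eq_inner he he, ip_eq_inner hl hl, ip_eq_inner hu hl,
    ip_eq_inner hu hu]
  generalize ip (skewEuler u) (sphLap (skewEuler u)) = m at *
  generalize hee.memLp.toLp _ = x2 at *
  generalize he.memLp.toLp _ = x1 at *
  generalize hl.memLp.toLp _ = y at *
  generalize hu.memLp.toLp _ = x0 at *
  simp only [inner_add_left, inner_add_right, inner_smul_left, inner_smul_right, conj_trivial,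
    real_inner_comm x1 x2, real_inner_comm x0 x2, real_inner_comm y x2, real_inner_comm x0 x1,
    real_inner_comm y x1, real_inner_comm y x0] at *
  simp only [r1, r2, r3, r4, r5]
  linarith

lemma ip_skewEuler_add_smul_self (hu : IsTestFunction U u) (a : ℝ) :
    ip (skewEuler u + a • u) (skewEuler u + a • u) =
      ip (skewEuler u) (skewEuler u) + a ^ 2 * ip u u := by
  have he := hu.skewEuler
  have r1 := ip_skewEuler_self hu
  have hT : (he.add (hu.smul a)).memLp.toLp _ = he.memLp.toLp _ + a • hu.memLp.toLp _ := rfl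
  rw [ip_eq_inner (he.add (hu.smul a)) (he.add (hu.smul a)), hT]
  rw [ip_eq_inner he hu] at r1
  rw [ip_eq_inner he he, ip_eq_inner hu hu]
  simp only [inner_add_left, inner_add_right, inner_smul_left, inner_smul_right, conj_trivial,
    real_inner_comm _ (hu.memLp.toLp _), r1]
  linarith

lemma ip_self_nonneg (u : Euc n → ℂ) : 0 ≤ ip u u :=
  integral_nonneg fun _ => real_inner_self_nonneg

/-- The weighted Hardy-Rellich inequality for every constant that is compatible with the
inequality on each of the eigenspaces of the spherical Laplacian. -/
lemma mul_gradEnergy_le_laplaceEnergy (hn : 2 ≤ n) {γ C a b : ℝ} (ha : a = (4 - n - γ) / 2)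
    (hb : b = (n - γ) / 2) (hC : C ≤ b ^ 2)
    (hq : ∀ k, C * (a ^ 2 + eigval n k) ≤ (eigval n k - a * b) ^ 2) {f : Euc n → ℂ}
    (hf : IsTestFunction U f) (h0 : (0 : Euc n) ∉ U) (hU : U ⊆ Ω) :
    C * gradEnergy γ Ω f ≤ laplaceEnergy γ Ω f := by
  let s : ℝ := (4 - γ) / 2
  have hs : 2 * s = 4 - γ := by simp only [s]; ring
  have hu := hf.powMul h0 (-s)
  have hfu : f = powMul s (powMul (-s) f) := by
    ext x
    by_cases hx : x = 0
    · have : f 0 = 0 := image_eq_zero_of_notMem_tsupport fun h => h0 (hf.2.2 h)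
      simp [powMul, hx, this]
    · have hr : 0 < ‖x‖ := norm_pos_iff.2 hx
      simp only [powMul, smul_smul]
      rw [← Real.rpow_add hr]
      simp
  have ha' : s - n / 2 = a := by rw [ha]; ring
  have hb' : s + n / 2 - 2 = b := by rw [hb]; ring
  rw [hfu, gradEnergy_powMul hs hu h0 hU, laplaceEnergy_powMul hs hu h0 hU, ha', hb',
    ip_conjLaplacian_self hu, ip_skewEuler_add_smul_self hu]
  set u := powMul (-s) f
  -- the polynomial is `(λ - a b)² - C (a² + λ)`
  have h1 := quadratic_sphLap_nonneg hn hu (β := -(2 * (a * b) + C))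
    (c := (a * b) ^ 2 - C * a ^ 2) fun k => by nlinarith [hq k]
  have h2 := ip_self_nonneg (skewEuler (skewEuler u))
  have h3 := mul_nonneg (add_nonneg (sq_nonneg a) (sub_nonneg.2 hC))
    (ip_self_nonneg (skewEuler u))
  have h4 : 0 ≤ ip (skewEuler u) (sphLap (skewEuler u)) := by
    rw [ip_sphLap_self hu.skewEuler]
    exact integral_nonneg fun x => by positivity
  nlinarith

end Energies

/-! ### Separated functions -/

section Separated

variable {φ : Euc n → ℂ} {μ R : ℝ}

lemma rayExt_smul (φ : Euc n → ℂ) {t : ℝ} (ht : 0 < t) (x : Euc n) :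
    rayExt φ (t • x) = rayExt φ x := by
  simp only [rayExt, norm_smul, Real.norm_of_nonneg ht.le, smul_smul, mul_inv]
  congr 2
  field_simp

lemma rayExt_of_norm_eq_one (φ : Euc n → ℂ) {x : Euc n} (hx : ‖x‖ = 1) : rayExt φ x = φ x := by
  simp [rayExt, hx]

lemma euler_rayExt {x : Euc n} (hφ : DifferentiableAt ℝ (rayExt φ) x) :
    euler (rayExt φ) x = 0 := by
  rw [euler_eq_of_homogeneous (d := 0) hφ fun t ht => by simp [rayExt_smul φ ht]]
  simp

/-- The Laplacian of a function that is constant along rays is purely spherical. -/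
lemma norm_sq_smul_laplacian_rayExt (hφ : ContDiffOn ℝ ∞ (rayExt φ) {0}ᶜ) {x : Euc n}
    (hx : x ≠ 0) : ‖x‖ ^ 2 • Laplacian.laplacian (rayExt φ) x = -sphLap (rayExt φ) x := by
  have hs : ∀ y : Euc n, y ≠ 0 → ContDiffAt ℝ ∞ (rayExt φ) y := fun y hy =>
    hφ.contDiffAt (isOpen_compl_singleton.mem_nhds hy)
  have h0 : euler (rayExt φ) =ᶠ[𝓝 x] fun _ => 0 := by
    filter_upwards [isOpen_ne.mem_nhds hx] with y hy
    exact euler_rayExt ((hs y hy).differentiableAt (by simp))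
  rw [norm_sq_smul_laplacian (hs x hx), (euler_congr h0).eq_of_nhds, h0.eq_of_nhds]
  simp [euler, linDeriv]

namespace IsSphericalEigenfunction

lemma contDiffAt (hφ : IsSphericalEigenfunction μ φ) {x : Euc n} (hx : x ≠ 0) :
    ContDiffAt ℝ ∞ (rayExt φ) x :=
  hφ.smooth.contDiffAt (isOpen_compl_singleton.mem_nhds hx)

lemma sphLap_eq (hφ : IsSphericalEigenfunction μ φ) {x : Euc n} (hx : x ≠ 0) :
    sphLap (rayExt φ) x = μ • rayExt φ x := by
  have hr : 0 < ‖x‖ := norm_pos_iff.2 hx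
  have hy : ‖‖x‖⁻¹ • x‖ = 1 := by
    rw [norm_smul, norm_inv, norm_norm, inv_mul_cancel₀ hr.ne']
  have h1 := hφ.eigen _ hy
  have h2 := laplacian_smul_of_homogeneous (f := rayExt φ) (t := ‖x‖⁻¹) (c := 1)
    (fun x => by rw [rayExt_smul φ (by positivity), one_smul]) x
  have h3 := norm_sq_smul_laplacian_rayExt hφ.smooth hx
  have h4 : Laplacian.laplacian (rayExt φ) (‖x‖⁻¹ • x) =
      ‖x‖ ^ 2 • Laplacian.laplacian (rayExt φ) x := by
    rw [← one_smul ℝ (Laplacian.laplacian (rayExt φ) x), ← h2, smul_smul, inv_pow,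
      mul_inv_cancel₀ (by positivity), one_smul]
  rw [h4, h3, neg_neg] at h1
  rw [h1, Complex.real_smul]
  rfl

end IsSphericalEigenfunction

/-- A radial profile: a smooth function with support in the open interval `(0, R)`. -/
structure IsProfile (R : ℝ) (G : ℝ → ℝ) : Prop where
  contDiff : ContDiff ℝ ∞ G
  tsupport_subset : tsupport G ⊆ Set.Ioo 0 R

/-- The operator `r d/dr`. -/
noncomputable def theta (G : ℝ → ℝ) (r : ℝ) : ℝ := r * deriv G r

lemma IsProfile.theta {G : ℝ → ℝ} (hG : IsProfile R G) : IsProfile R (theta G) where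
  contDiff := contDiff_id.mul (contDiff_infty_iff_deriv.1 hG.contDiff).2
  tsupport_subset := (tsupport_mul_subset_right.trans (tsupport_deriv_subset)).trans
    hG.tsupport_subset

/-- The function `r^(-n/2) G(r) φ(θ)`. -/
noncomputable def sepFun (φ : Euc n → ℂ) (G : ℝ → ℝ) : Euc n → ℂ :=
  powMul (-((n : ℝ) / 2)) fun x => G ‖x‖ • rayExt φ x

lemma tsupport_sepFun_subset {G : ℝ → ℝ} :
    tsupport (sepFun φ G) ⊆ (fun x => ‖x‖) ⁻¹' tsupport G := by
  refine closure_minimal (fun x hx => subset_closure fun h => hx ?_)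
    ((isClosed_tsupport G).preimage continuous_norm)
  simp [sepFun, powMul, h]

lemma isTestFunction_sepFun (hφ : IsSphericalEigenfunction μ φ) {G : ℝ → ℝ}
    (hG : IsProfile R G) : IsTestFunction (Metric.ball 0 R \ {0}) (sepFun φ G) := by
  have h1 : tsupport (sepFun φ G) ⊆ Metric.ball 0 R \ {0} := fun x hx => by
    have := hG.tsupport_subset (tsupport_sepFun_subset hx)
    exact ⟨by simpa using this.2, norm_pos_iff.1 this.1⟩
  refine ⟨contDiff_iff_contDiffAt.2 fun x => ?_, ?_, h1⟩
  · by_cases hx : x = 0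
    · exact (contDiffAt_const (c := (0 : ℂ))).congr_of_eventuallyEq
        (notMem_tsupport_iff_eventuallyEq.1 fun h => (h1 h).2 hx)
    · exact (contDiffAt_norm_rpow _ hx).smul
        ((hG.contDiff.contDiffAt.comp x (contDiffAt_norm ℝ hx)).smul (hφ.contDiffAt hx))
  · exact (isCompact_closedBall (0 : Euc n) R).of_isClosed_subset (isClosed_tsupport _)
      (h1.trans (Set.sdiff_subset.trans Metric.ball_subset_closedBall))

lemma IsProfile.apply_zero {G : ℝ → ℝ} (hG : IsProfile R G) : G 0 = 0 :=
  image_eq_zero_of_notMem_tsupport fun h => (hG.tsupport_subset h).1.false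

lemma skewEuler_sepFun (hφ : IsSphericalEigenfunction μ φ) {G : ℝ → ℝ} (hG : IsProfile R G) :
    skewEuler (sepFun φ G) = sepFun φ (theta G) := by
  ext x
  by_cases hx : x = 0
  · subst hx
    have h1 := (isTestFunction_sepFun hφ hG).skewEuler
    rw [image_eq_zero_of_notMem_tsupport fun h => (h1.2.2 h).2 rfl]
    simp [sepFun, powMul, theta]
  · have hG' : DifferentiableAt ℝ G ‖x‖ := (hG.contDiff.differentiable (by simp)).differentiableAt
    have hr := isRadialAt_comp_norm hx hG.contDiff.contDiffAt
    have hd := hr.contDiffAt.differentiableAt (by simp)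
    have hΦ := (hφ.contDiffAt hx).differentiableAt (by simp)
    have h1 := euler_smul hd hΦ
    rw [euler_rayExt hΦ, euler_comp_norm hx hG', smul_zero, zero_add] at h1
    simp only [skewEuler, Pi.add_apply, Pi.smul_apply]
    rw [sepFun, euler_powMul hx (hd.fun_smul hΦ)]
    simp only [powMul, sepFun, Pi.add_apply, Pi.smul_apply, theta]
    rw [h1]
    module

lemma sphLap_sepFun (hφ : IsSphericalEigenfunction μ φ) {G : ℝ → ℝ} (hG : IsProfile R G) :
    sphLap (sepFun φ G) = μ • sepFun φ G := by
  ext x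
  by_cases hx : x = 0
  · subst hx
    have h1 := isTestFunction_sepFun hφ hG
    rw [image_eq_zero_of_notMem_tsupport fun h => (h1.sphLap.2.2 h).2 rfl]
    simp [sepFun, powMul, hG.apply_zero]
  · have hr := isRadialAt_comp_norm hx hG.contDiff.contDiffAt
    have hr' := isRadialAt_comp_norm hx (contDiffAt_rpow_of_pos (-((n : ℝ) / 2))
      (norm_pos_iff.2 hx))
    have h1 := sphLap_radial_smul hr (hφ.contDiffAt hx)
    have h2 := sphLap_radial_smul (f := fun y => G ‖y‖ • rayExt φ y) hr'
      (hr.contDiffAt.smul (hφ.contDiffAt hx))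
    rw [h1, hφ.sphLap_eq hx] at h2
    simp only [sepFun, powMul, Pi.smul_apply]
    refine Eq.trans h2 ?_
    module

/-- The energies of a separated function are those of its radial profile. -/
lemma energies_sepFun (hφ : IsSphericalEigenfunction μ φ) {G : ℝ → ℝ} (hG : IsProfile R G)
    {γ a b : ℝ} (ha : a = (4 - n - γ) / 2) (hb : b = (n - γ) / 2) :
    laplaceEnergy γ (Metric.ball 0 R) (powMul ((4 - γ) / 2) (sepFun φ G)) =
        ip (sepFun φ (theta (theta G))) (sepFun φ (theta (theta G))) +
        (a ^ 2 + b ^ 2 + 2 * μ) * ip (sepFun φ (theta G)) (sepFun φ (theta G)) +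
        (μ - a * b) ^ 2 * ip (sepFun φ G) (sepFun φ G) ∧
    gradEnergy γ (Metric.ball 0 R) (powMul ((4 - γ) / 2) (sepFun φ G)) =
        ip (sepFun φ (theta G)) (sepFun φ (theta G)) +
        (a ^ 2 + μ) * ip (sepFun φ G) (sepFun φ G) := by
  have hs : 2 * ((4 - γ) / 2) = 4 - γ := by ring
  have hu := isTestFunction_sepFun hφ hG
  have h0 : (0 : Euc n) ∉ Metric.ball (0 : Euc n) R \ {0} := by simp
  have ha' : (4 - γ) / 2 - n / 2 = a := by rw [ha]; ring
  have hb' : (4 - γ) / 2 + n / 2 - 2 = b := by rw [hb]; ring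
  rw [laplaceEnergy_powMul hs hu h0 Set.sdiff_subset, gradEnergy_powMul hs hu h0 Set.sdiff_subset,
    ha', hb', ip_conjLaplacian_self hu, ip_skewEuler_add_smul_self hu, skewEuler_sepFun hφ hG,
    skewEuler_sepFun hφ hG.theta, sphLap_sepFun hφ hG, sphLap_sepFun hφ hG.theta]
  simp only [ip_smul_right, ip_comm (μ • sepFun φ G)]
  constructor <;> ring

end Separated

/-! ### Integrals over spherical shells -/

section Shells

open scoped Pointwise

variable {φ : Euc n → ℂ} {μ R : ℝ}

/-- The spherical shell `a < |x| ≤ b`. -/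
def shell (n : ℕ) (a b : ℝ) : Set (Euc n) := {x | ‖x‖ ∈ Set.Ioc a b}

/-- The density `|x|^(-n) |φ(θ)|²`. -/
noncomputable def rayDensity (φ : Euc n → ℂ) (x : Euc n) : ℝ := (‖x‖ ^ n)⁻¹ * ‖rayExt φ x‖ ^ 2

/-- The integral of `|x|^(-n) |φ(θ)|²` over a spherical shell. -/
noncomputable def shellMass (φ : Euc n → ℂ) (a b : ℝ) : ℝ := ∫ x in shell n a b, rayDensity φ x

lemma measurableSet_shell (a b : ℝ) : MeasurableSet (shell n a b) :=
  measurableSet_Ioc.preimage continuous_norm.measurable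

lemma rayDensity_nonneg (φ : Euc n → ℂ) (x : Euc n) : 0 ≤ rayDensity φ x := by
  unfold rayDensity; positivity

lemma continuousAt_rayDensity (hφ : IsSphericalEigenfunction μ φ) {x : Euc n} (hx : x ≠ 0) :
    ContinuousAt (rayDensity φ) x := by
  have h1 := (hφ.contDiffAt hx).continuousAt
  have h2 : ‖x‖ ^ n ≠ 0 := pow_ne_zero _ (norm_ne_zero_iff.2 hx)
  unfold rayDensity
  exact ((continuous_norm.continuousAt.pow n).inv₀ h2).mul (h1.norm.pow 2)

lemma integrableOn_shell (hφ : IsSphericalEigenfunction μ φ) {a : ℝ} (ha : 0 < a) (b : ℝ) :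
    IntegrableOn (rayDensity φ) (shell n a b) := by
  have hK : IsCompact ((fun x : Euc n => ‖x‖) ⁻¹' Set.Icc a b) := by
    refine (isCompact_closedBall (0 : Euc n) b).of_isClosed_subset
      (isClosed_Icc.preimage continuous_norm) fun x hx => ?_
    simpa using hx.2
  have hc : ContinuousOn (rayDensity φ) ((fun x : Euc n => ‖x‖) ⁻¹' Set.Icc a b) := fun x hx =>
    (continuousAt_rayDensity hφ (norm_pos_iff.1 (ha.trans_le hx.1))).continuousWithinAt
  exact (hc.integrableOn_compact hK).mono_set fun x hx => ⟨hx.1.le, hx.2⟩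

lemma shellMass_add (hφ : IsSphericalEigenfunction μ φ) {a b c : ℝ} (ha : 0 < a) (hab : a ≤ b)
    (hbc : b ≤ c) : shellMass φ a b + shellMass φ b c = shellMass φ a c := by
  have h : shell n a c = shell n a b ∪ shell n b c := by
    ext x
    have := congr(‖x‖ ∈ $(Set.Ioc_union_Ioc_eq_Ioc hab hbc))
    simpa [shell] using this.symm
  rw [shellMass, shellMass, shellMass, h, setIntegral_union _ (measurableSet_shell b c)
    (integrableOn_shell hφ ha b) (integrableOn_shell hφ (ha.trans_le hab) c)]
  exact Set.disjoint_left.2 fun x hx hx' => absurd hx.2 (not_le.2 hx'.1)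

/-- The measure `|x|^(-n) dx` is invariant under dilations. -/
lemma shellMass_scale (φ : Euc n → ℂ) {t : ℝ} (ht : 0 < t) (a b : ℝ) :
    shellMass φ (t * a) (t * b) = shellMass φ a b := by
  have hset : shell n (t * a) (t * b) = t • shell n a b := by
    ext x
    rw [Set.mem_smul_set_iff_inv_smul_mem₀ ht.ne']
    simp only [shell, Set.mem_ofPred_eq, Set.mem_Ioc, norm_smul, norm_inv,
      Real.norm_of_nonneg ht.le]
    rw [lt_inv_mul_iff₀ ht, inv_mul_le_iff₀ ht]
  have h := Measure.setIntegral_comp_smul_of_pos (volume : Measure (Euc n)) (rayDensity φ)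
    (shell n a b) ht
  have hk : ∀ x, rayDensity φ (t • x) = (t ^ n)⁻¹ * rayDensity φ x := fun x => by
    simp only [rayDensity, rayExt_smul φ ht, norm_smul, Real.norm_of_nonneg ht.le, mul_pow,
      mul_inv, mul_assoc]
  simp only [hk, integral_const_mul, finrank_euclideanSpace, Fintype.card_fin, smul_eq_mul] at h
  rw [shellMass, shellMass, hset]
  exact (mul_left_cancel₀ (by positivity) h).symm

lemma shellMass_pos (hφ : IsSphericalEigenfunction μ φ) {a b : ℝ} (ha : 0 < a) (hab : a < b) :
    0 < shellMass φ a b := by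
  rw [shellMass, setIntegral_pos_iff_support_of_nonneg_ae
    (.of_forall fun x => rayDensity_nonneg φ x) (integrableOn_shell hφ ha b)]
  -- an open part of the shell on which the density is positive
  let O : Set (Euc n) := (fun x : Euc n => ‖x‖) ⁻¹' Set.Ioo a b ∩ {x | rayExt φ x ≠ 0}
  have hO : IsOpen O := by
    refine isOpen_iff_mem_nhds.2 fun x hx => ?_
    have hx0 : x ≠ 0 := norm_pos_iff.1 (ha.trans hx.1.1)
    exact inter_mem ((isOpen_Ioo.preimage continuous_norm).mem_nhds hx.1)
      ((hφ.contDiffAt hx0).continuousAt.eventually_ne hx.2)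
  obtain ⟨y, hy, hφy⟩ := hφ.nonzero
  have hne : O.Nonempty := by
    refine ⟨((a + b) / 2) • y, ?_, ?_⟩
    · have : 0 ≤ (a + b) / 2 := by linarith
      simp only [Set.mem_preimage, norm_smul, hy, Real.norm_of_nonneg this, mul_one, Set.mem_Ioo]
      constructor <;> linarith
    · rw [Set.mem_ofPred_eq, rayExt_smul φ (by linarith), rayExt_of_norm_eq_one φ hy]
      exact hφy
  refine (hO.measure_pos volume hne).trans_le (measure_mono fun x hx => ⟨?_, hx.1.1, hx.1.2.le⟩)
  have hx0 : ‖x‖ ≠ 0 := (ha.trans hx.1.1).ne'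
  have h2 : rayExt φ x ≠ 0 := hx.2
  simp only [Function.mem_support, rayDensity]
  positivity

/-- A dyadic decomposition: the shells `2^(-k-1) c < |x| ≤ 2^(-k) c` all have the same mass. -/
lemma shellMass_two_pow (hφ : IsSphericalEigenfunction μ φ) {c : ℝ} (hc : 0 < c) (K : ℕ) :
    shellMass φ ((1 / 2) ^ K * c) c = K * shellMass φ (1 / 2 * c) c := by
  induction K with
  | zero => simp [shellMass, shell]
  | succ K ih =>
    have h1 : (1 / 2 : ℝ) ^ (K + 1) * c = 1 / 2 * ((1 / 2) ^ K * c) := by ring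
    have h2 : (1 / 2 : ℝ) ^ K * c ≤ c := mul_le_of_le_one_left hc.le
      (pow_le_one₀ (by norm_num) (by norm_num))
    rw [← shellMass_add hφ (b := 1 / 2 * c) (by positivity) (by rw [h1]; linarith) (by linarith),
      h1, shellMass_scale φ (by norm_num), ih]
    push_cast
    ring

lemma inner_sepFun (φ : Euc n → ℂ) {G : ℝ → ℝ} (hG : G 0 = 0) (x : Euc n) :
    inner ℝ (sepFun φ G x) (sepFun φ G x) = G ‖x‖ ^ 2 * rayDensity φ x := by
  rw [real_inner_self_eq_norm_sq, sepFun, powMul, norm_smul, norm_smul, rayDensity]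
  by_cases hx : x = 0
  · simp [hx, hG]
  · have hr : 0 < ‖x‖ := norm_pos_iff.2 hx
    rw [Real.norm_of_nonneg (by positivity), mul_pow, mul_pow, ← Real.rpow_natCast (_ ^ _),
      ← Real.rpow_mul hr.le, Real.norm_eq_abs, sq_abs, ← Real.rpow_natCast ‖x‖ n,
      ← Real.rpow_neg hr.le]
    have : -((n : ℝ) / 2) * (2 : ℕ) = -n := by push_cast; ring
    rw [this]
    ring

lemma ip_sepFun {G : ℝ → ℝ} (hG : IsProfile R G) :
    ip (sepFun φ G) (sepFun φ G) = ∫ x, G ‖x‖ ^ 2 * rayDensity φ x := by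
  simp only [ip, inner_sepFun φ hG.apply_zero]

lemma integrable_sepFun (hφ : IsSphericalEigenfunction μ φ) {G : ℝ → ℝ} (hG : IsProfile R G) :
    Integrable fun x => G ‖x‖ ^ 2 * rayDensity φ x := by
  have h := isTestFunction_sepFun hφ hG
  simpa only [inner_sepFun φ hG.apply_zero] using integrable_inner h h.1.continuous

/-- A pointwise bound of profiles up to two shells gives a bound of the norms. -/
lemma ip_sepFun_le (hφ : IsSphericalEigenfunction μ φ) {G H : ℝ → ℝ} (hG : IsProfile R G)
    (hH : IsProfile R H) {κ C a b c d : ℝ} (ha : 0 < a) (hc : 0 < c)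
    (h : ∀ r, H r ^ 2 ≤ κ * G r ^ 2 +
      C * ((Set.Ioc a b).indicator 1 r + (Set.Ioc c d).indicator 1 r)) :
    ip (sepFun φ H) (sepFun φ H) ≤ κ * ip (sepFun φ G) (sepFun φ G) +
      C * (shellMass φ a b + shellMass φ c d) := by
  have hind : ∀ a b : ℝ, ∀ x : Euc n, (Set.Ioc a b).indicator 1 ‖x‖ * rayDensity φ x =
      (shell n a b).indicator (rayDensity φ) x := fun a b x => by
    by_cases hx : ‖x‖ ∈ Set.Ioc a b
    · rw [Set.indicator_of_mem hx, Set.indicator_of_mem (show x ∈ shell n a b from hx)]; simp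
    · rw [Set.indicator_of_notMem hx, Set.indicator_of_notMem (show x ∉ shell n a b from hx)]; simp
  have hi1 := (integrable_indicator_iff (measurableSet_shell a b)).2 (integrableOn_shell hφ ha b)
  have hi2 := (integrable_indicator_iff (measurableSet_shell c d)).2 (integrableOn_shell hφ hc d)
  rw [ip_sepFun hH, ip_sepFun hG, shellMass, shellMass,
    ← integral_indicator (measurableSet_shell a b), ← integral_indicator (measurableSet_shell c d),
    ← integral_add hi1 hi2, ← integral_const_mul, ← integral_const_mul,
    ← integral_add ((integrable_sepFun hφ hG).const_mul κ) ((hi1.fun_add hi2).const_mul C)]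
  refine integral_mono (integrable_sepFun hφ hH)
    (((integrable_sepFun hφ hG).const_mul κ).fun_add ((hi1.fun_add hi2).const_mul C)) fun x => ?_
  have := mul_le_mul_of_nonneg_right (h ‖x‖) (rayDensity_nonneg φ x)
  refine this.trans (le_of_eq ?_)
  rw [← hind, ← hind]
  ring

lemma mul_shellMass_le_ip (hφ : IsSphericalEigenfunction μ φ) {G : ℝ → ℝ} (hG : IsProfile R G)
    {κ a b : ℝ} (ha : 0 < a) (h : ∀ r ∈ Set.Ioc a b, κ ≤ G r ^ 2) :
    κ * shellMass φ a b ≤ ip (sepFun φ G) (sepFun φ G) := by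
  rw [ip_sepFun hG, shellMass, ← integral_const_mul]
  refine (setIntegral_mono_on ((integrableOn_shell hφ ha b).const_mul κ)
    (integrable_sepFun hφ hG).integrableOn (measurableSet_shell a b) fun x hx =>
      mul_le_mul_of_nonneg_right (h _ hx) (rayDensity_nonneg φ x)).trans ?_
  exact setIntegral_le_integral (integrable_sepFun hφ hG)
    (.of_forall fun x => mul_nonneg (sq_nonneg _) (rayDensity_nonneg φ x))

end Shells

/-! ### The trial functions -/

section Trial

variable {φ : Euc n → ℂ} {ψ : ℝ → ℝ} {μ R ε γ : ℝ}

/-- The radial profile `r^(ε/2) ψ_ε(r)` of the trial function. -/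
noncomputable def trialProfile (R : ℝ) (ψ : ℝ → ℝ) (ε r : ℝ) : ℝ :=
  r ^ (ε / 2) * scaledCutoff R ψ ε r

/-- Near every point, `ψ_ε` is the rescaled cutoff, or constant, or the original cutoff. -/
lemma scaledCutoff_cases (hψ : IsCutoff R ψ) (hR : 0 < R) (hε : 0 < ε) (hε1 : ε < 1) (r : ℝ) :
    (r < 4 * (ε * R) / 5 ∧ scaledCutoff R ψ ε =ᶠ[𝓝 r] fun r => ψ (r / ε)) ∨
    (ε * R / 5 < r ∧ r < 4 * R / 5 ∧ scaledCutoff R ψ ε =ᶠ[𝓝 r] fun _ => 1) ∨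
    (R / 5 < r ∧ scaledCutoff R ψ ε =ᶠ[𝓝 r] ψ) := by
  have hεR : ε * R < R := by nlinarith
  have hεR0 : 0 < ε * R := by positivity
  by_cases h1 : r < 4 * (ε * R) / 5
  · refine .inl ⟨h1, ?_⟩
    filter_upwards [gt_mem_nhds h1] with t ht
    by_cases h : t ≤ ε * R / 5
    · simp [scaledCutoff, h]
    · have h' : t ≤ 4 * R / 5 := by linarith
      rw [scaledCutoff, if_neg h, if_pos h', hψ.one_mid]
      rw [not_le] at h
      exact ⟨by rw [le_div_iff₀ hε]; linarith, by rw [div_le_iff₀ hε]; linarith⟩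
  · by_cases h2 : r < 4 * R / 5
    · refine .inr (.inl ⟨by linarith, h2, ?_⟩)
      filter_upwards [gt_mem_nhds h2, lt_mem_nhds (show ε * R / 5 < r by linarith)] with t ht ht'
      rw [scaledCutoff, if_neg (by linarith), if_pos ht.le]
    · refine .inr (.inr ⟨by linarith, ?_⟩)
      filter_upwards [lt_mem_nhds (show R / 5 < r by linarith)] with t ht
      rw [scaledCutoff, if_neg (by linarith)]
      split_ifs with h
      · exact (hψ.one_mid t ⟨ht.le, h⟩).symm
      · rfl

lemma contDiff_scaledCutoff (hψ : IsCutoff R ψ) (hR : 0 < R) (hε : 0 < ε) (hε1 : ε < 1) :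
    ContDiff ℝ ∞ (scaledCutoff R ψ ε) := by
  refine contDiff_iff_contDiffAt.2 fun r => ?_
  rcases scaledCutoff_cases hψ hR hε hε1 r with ⟨_, h⟩ | ⟨_, _, h⟩ | ⟨_, h⟩
  · exact ((hψ.smooth.comp (contDiff_id.div_const ε)).contDiffAt).congr_of_eventuallyEq h
  · exact contDiffAt_const.congr_of_eventuallyEq h
  · exact hψ.smooth.contDiffAt.congr_of_eventuallyEq h

lemma scaledCutoff_eq_zero_of_le (hψ : IsCutoff R ψ) (hR : 0 < R) (hε : 0 < ε) {r : ℝ}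
    (hr : r ≤ ε * R / 10) : scaledCutoff R ψ ε r = 0 := by
  have : 0 < ε * R := by positivity
  rw [scaledCutoff, if_pos (by linarith)]
  exact hψ.zero_left _ (by rw [div_le_iff₀ hε]; linarith)

lemma scaledCutoff_eq_zero_of_ge (hψ : IsCutoff R ψ) (hR : 0 < R) (hε1 : ε < 1) {r : ℝ}
    (hr : 9 * R / 10 ≤ r) : scaledCutoff R ψ ε r = 0 := by
  have : ε * R < R := by nlinarith
  rw [scaledCutoff, if_neg (by linarith), if_neg (by linarith)]
  exact hψ.zero_right _ hr

lemma isProfile_trialProfile (hψ : IsCutoff R ψ) (hR : 0 < R) (hε : 0 < ε) (hε1 : ε < 1) :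
    IsProfile R (trialProfile R ψ ε) where
  contDiff := by
    refine contDiff_iff_contDiffAt.2 fun r => ?_
    by_cases hr : r < ε * R / 10
    · refine (contDiffAt_const (c := (0 : ℝ))).congr_of_eventuallyEq ?_
      filter_upwards [gt_mem_nhds hr] with t ht
      rw [trialProfile, scaledCutoff_eq_zero_of_le hψ hR hε ht.le, mul_zero]
    · have : 0 < ε * R := by positivity
      exact (contDiffAt_rpow_of_pos _ (by linarith)).mul
        (contDiff_scaledCutoff hψ hR hε hε1).contDiffAt
  tsupport_subset := by
    have : 0 < ε * R := by positivity
    have h : tsupport (trialProfile R ψ ε) ⊆ Set.Icc (ε * R / 10) (9 * R / 10) := by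
      refine closure_minimal (fun r hr => ?_) isClosed_Icc
      by_contra h
      rw [Set.mem_Icc, not_and_or, not_le, not_le] at h
      refine hr ?_
      rcases h with h | h
      · rw [trialProfile, scaledCutoff_eq_zero_of_le hψ hR hε h.le, mul_zero]
      · rw [trialProfile, scaledCutoff_eq_zero_of_ge hψ hR hε1 h.le, mul_zero]
    exact h.trans fun r hr => ⟨by linarith [hr.1], by linarith [hr.2]⟩

lemma trialFunction_eq (hψ : IsCutoff R ψ) (hR : 0 < R) (hε : 0 < ε) :
    trialFunction γ R ψ φ ε = powMul ((4 - γ) / 2) (sepFun φ (trialProfile R ψ ε)) := by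
  ext x
  have h : ‖x‖ ^ ((4 - (n : ℝ) - γ + ε) / 2) * scaledCutoff R ψ ε ‖x‖ =
      ‖x‖ ^ ((4 - γ) / 2) * (‖x‖ ^ (-((n : ℝ) / 2)) *
        (‖x‖ ^ (ε / 2) * scaledCutoff R ψ ε ‖x‖)) := by
    by_cases hx : x = 0
    · have h0 : scaledCutoff R ψ ε 0 = 0 :=
        scaledCutoff_eq_zero_of_le hψ hR hε (by positivity)
      simp [hx, h0]
    · have hr : 0 < ‖x‖ := norm_pos_iff.2 hx
      rw [← mul_assoc (_ ^ _), ← mul_assoc, ← Real.rpow_add hr, ← Real.rpow_add hr]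
      congr 2
      ring
  rw [trialFunction, h]
  simp only [powMul, sepFun, trialProfile, Complex.real_smul]
  push_cast
  ring

lemma theta_congr {G H : ℝ → ℝ} {r : ℝ} (h : G =ᶠ[𝓝 r] H) : theta G =ᶠ[𝓝 r] theta H := by
  filter_upwards [h.deriv] with t ht
  simp [theta, ht]

lemma theta_const (c r : ℝ) : theta (fun _ => c) r = 0 := by simp [theta]

lemma theta_comp_div (G : ℝ → ℝ) (c : ℝ) :
    theta (fun r => G (r / c)) = fun r => theta G (r / c) := by
  ext r
  have h := deriv_comp_mul_left (c⁻¹) G r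
  simp only [theta, div_eq_inv_mul, h, smul_eq_mul]
  ring

lemma theta_rpow_mul {H : ℝ → ℝ} {r : ℝ} (s : ℝ) (hr : 0 < r) (hH : DifferentiableAt ℝ H r) :
    theta (fun r => r ^ s * H r) r = r ^ s * (s * H r + theta H r) := by
  have h1 := ((Real.hasDerivAt_rpow_const (p := s) (.inl hr.ne')).mul hH.hasDerivAt).deriv
  rw [theta, theta]
  change r * deriv ((fun r => r ^ s) * H) r = _
  rw [h1, Real.rpow_sub_one hr.ne']
  field_simp

lemma IsProfile.hasCompactSupport {G : ℝ → ℝ} (hG : IsProfile R G) : HasCompactSupport G :=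
  isCompact_Icc.of_isClosed_subset (isClosed_tsupport G)
    (hG.tsupport_subset.trans Set.Ioo_subset_Icc_self)

lemma isProfile_cutoff (hψ : IsCutoff R ψ) (hR : 0 < R) : IsProfile R ψ where
  contDiff := hψ.smooth
  tsupport_subset := by
    have h : tsupport ψ ⊆ Set.Icc (R / 10) (9 * R / 10) := by
      refine closure_minimal (fun r hr => ?_) isClosed_Icc
      by_contra h
      rw [Set.mem_Icc, not_and_or, not_le, not_le] at h
      exact hr (h.elim (fun h => hψ.zero_left r h.le) fun h => hψ.zero_right r h.le)
    exact h.trans fun r hr => ⟨by linarith [hr.1], by linarith [hr.2]⟩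

/-- Both `θ ψ` and `θ² ψ`, for `θ = r d/dr`, are bounded. -/
lemma exists_theta_bound (hψ : IsCutoff R ψ) (hR : 0 < R) :
    ∃ D : ℝ, ∀ r, |theta ψ r| ≤ D ∧ |theta (theta ψ) r| ≤ D := by
  have hp := isProfile_cutoff hψ hR
  obtain ⟨D, hD⟩ := hp.theta.hasCompactSupport.exists_bound_of_continuous
    hp.theta.contDiff.continuous
  obtain ⟨D', hD'⟩ := hp.theta.theta.hasCompactSupport.exists_bound_of_continuous
    hp.theta.theta.contDiff.continuous
  exact ⟨max D D', fun r =>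
    ⟨(hD r).trans (le_max_left _ _), (hD' r).trans (le_max_right _ _)⟩⟩

lemma theta_eq_zero_of_const {G : ℝ → ℝ} {c r : ℝ} (h : G =ᶠ[𝓝 r] fun _ => c) :
    theta G r = 0 ∧ theta (theta G) r = 0 := by
  have h1 : theta G =ᶠ[𝓝 r] fun _ => 0 := by
    filter_upwards [theta_congr h] with t ht
    rw [ht, theta_const]
  exact ⟨h1.eq_of_nhds, by rw [(theta_congr h1).eq_of_nhds, theta_const]⟩

lemma theta_cutoff_eq_zero (hψ : IsCutoff R ψ) {r : ℝ}
    (h : r < R / 10 ∨ (R / 5 < r ∧ r < 4 * R / 5) ∨ 9 * R / 10 < r) :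
    theta ψ r = 0 ∧ theta (theta ψ) r = 0 := by
  rcases h with h | ⟨h, h'⟩ | h
  · refine theta_eq_zero_of_const (c := 0) ?_
    filter_upwards [gt_mem_nhds h] with t ht using hψ.zero_left t ht.le
  · refine theta_eq_zero_of_const (c := 1) ?_
    filter_upwards [lt_mem_nhds h, gt_mem_nhds h'] with t ht ht' using hψ.one_mid t ⟨ht.le, ht'.le⟩
  · refine theta_eq_zero_of_const (c := 0) ?_
    filter_upwards [lt_mem_nhds h] with t ht using hψ.zero_right t ht.le

/-- The `θ`-derivatives of `ψ_ε` live on two shells and are bounded uniformly in `ε`. -/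
lemma theta_scaledCutoff_bound (hψ : IsCutoff R ψ) (hR : 0 < R) {D : ℝ}
    (hD : ∀ r, |theta ψ r| ≤ D ∧ |theta (theta ψ) r| ≤ D) (hε : 0 < ε) (hε1 : ε < 1) (r : ℝ) :
    (theta (scaledCutoff R ψ ε) r = 0 ∧ theta (theta (scaledCutoff R ψ ε)) r = 0) ∨
    ((r ∈ Set.Ioc (ε * (R / 20)) (ε * (R / 5)) ∨ r ∈ Set.Ioc (R / 5) R) ∧
      |theta (scaledCutoff R ψ ε) r| ≤ D ∧ |theta (theta (scaledCutoff R ψ ε)) r| ≤ D) := by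
  rcases scaledCutoff_cases hψ hR hε hε1 r with ⟨hr, h⟩ | ⟨_, _, h⟩ | ⟨hr, h⟩
  · rw [(theta_congr h).eq_of_nhds, (theta_congr (theta_congr h)).eq_of_nhds, theta_comp_div,
      theta_comp_div]
    by_cases hs : r ∈ Set.Ioc (ε * (R / 20)) (ε * (R / 5))
    · exact .inr ⟨.inl hs, hD _⟩
    · refine .inl (theta_cutoff_eq_zero hψ ?_)
      rw [Set.mem_Ioc, not_and_or, not_lt, not_le] at hs
      rcases hs with hs | hs
      · left
        rw [div_lt_iff₀ hε]
        nlinarith [mul_pos hε hR]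
      · right; left
        rw [lt_div_iff₀ hε, div_lt_iff₀ hε]
        constructor <;> linarith
  · exact .inl (theta_eq_zero_of_const h)
  · rw [(theta_congr h).eq_of_nhds, (theta_congr (theta_congr h)).eq_of_nhds]
    by_cases hs : r ≤ R
    · exact .inr ⟨.inr ⟨hr, hs⟩, hD _⟩
    · exact .inl (theta_cutoff_eq_zero hψ (.inr (.inr (by linarith))))

lemma trial_derivative_sq_le {x y D : ℝ} (hε : 0 < ε) (hε1 : ε < 1) (q : ℝ) (hx : x ^ 2 ≤ D ^ 2)
    (hy : y ^ 2 ≤ D ^ 2) :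
    (ε / 2 * q + x) ^ 2 ≤ ε * q ^ 2 + 8 * D ^ 2 ∧
    (ε / 2 * (ε / 2 * q + x) + (ε / 2 * x + y)) ^ 2 ≤ ε * q ^ 2 + 8 * D ^ 2 := by
  have hε2 : ε ^ 2 ≤ ε := pow_le_of_le_one hε.le hε1.le two_ne_zero
  have hε4 : ε ^ 4 ≤ ε := pow_le_of_le_one hε.le hε1.le four_ne_zero
  have h2 := mul_le_mul_of_nonneg_right hε2 (sq_nonneg q)
  have h4 := mul_le_mul_of_nonneg_right hε4 (sq_nonneg q)
  have hq := mul_nonneg hε.le (sq_nonneg q)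
  have hD := sq_nonneg D
  have hxx : ε ^ 2 * x ^ 2 ≤ x ^ 2 :=
    mul_le_of_le_one_left (sq_nonneg x) (pow_le_one₀ hε.le hε1.le)
  constructor
  · linarith [sq_nonneg (ε / 2 * q - x)]
  · linarith [sq_nonneg (ε ^ 2 / 4 * q - ε * x), sq_nonneg (ε ^ 2 / 4 * q - y),
      sq_nonneg (ε * x - y)]

/-- Pointwise bounds of the `θ`-derivatives of the trial profile: up to a multiple of the profile
that vanishes as `ε → 0` they are bounded and live on two shells. -/
lemma theta_trialProfile_sq_le (hψ : IsCutoff R ψ) (hR : 0 < R) {D : ℝ}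
    (hD : ∀ r, |theta ψ r| ≤ D ∧ |theta (theta ψ) r| ≤ D) (hε : 0 < ε) (hε1 : ε < 1) (r : ℝ) :
    theta (trialProfile R ψ ε) r ^ 2 ≤ ε * trialProfile R ψ ε r ^ 2 +
      8 * (1 + R) * D ^ 2 * ((Set.Ioc (ε * (R / 20)) (ε * (R / 5))).indicator 1 r +
        (Set.Ioc (R / 5) R).indicator 1 r) ∧
    theta (theta (trialProfile R ψ ε)) r ^ 2 ≤ ε * trialProfile R ψ ε r ^ 2 +
      8 * (1 + R) * D ^ 2 * ((Set.Ioc (ε * (R / 20)) (ε * (R / 5))).indicator 1 r +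
        (Set.Ioc (R / 5) R).indicator 1 r) := by
  have hεR : 0 < ε * R := by positivity
  set S : ℝ := (Set.Ioc (ε * (R / 20)) (ε * (R / 5))).indicator 1 r +
        (Set.Ioc (R / 5) R).indicator 1 r with hS
  have hi : ∀ a b : ℝ, (0 : ℝ) ≤ (Set.Ioc a b).indicator 1 r := fun a b =>
    Set.indicator_nonneg (fun _ _ => zero_le_one) _
  have hS0 : 0 ≤ S := add_nonneg (hi _ _) (hi _ _)
  have hC : 0 ≤ 8 * (1 + R) * D ^ 2 * S := by positivity
  by_cases hr : r < ε * R / 10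
  · have h0 : trialProfile R ψ ε =ᶠ[𝓝 r] fun _ => 0 := by
      filter_upwards [gt_mem_nhds hr] with t ht
      rw [trialProfile, scaledCutoff_eq_zero_of_le hψ hR hε ht.le, mul_zero]
    rw [(theta_eq_zero_of_const h0).1, (theta_eq_zero_of_const h0).2, h0.eq_of_nhds]
    simpa using hC
  have hr0 : 0 < r := by linarith
  have hs := contDiff_scaledCutoff hψ hR hε hε1
  have hs1 : ContDiff ℝ ∞ (theta (scaledCutoff R ψ ε)) :=
    contDiff_id.mul (contDiff_infty_iff_deriv.1 hs).2
  have e1 : ∀ t, 0 < t → theta (trialProfile R ψ ε) t = t ^ (ε / 2) *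
      (ε / 2 * scaledCutoff R ψ ε t + theta (scaledCutoff R ψ ε) t) := fun t ht =>
    theta_rpow_mul (ε / 2) ht (hs.differentiable (by simp)).differentiableAt
  have e2 : theta (theta (trialProfile R ψ ε)) r = r ^ (ε / 2) *
      (ε / 2 * (ε / 2 * scaledCutoff R ψ ε r + theta (scaledCutoff R ψ ε) r) +
      (ε / 2 * theta (scaledCutoff R ψ ε) r + theta (theta (scaledCutoff R ψ ε)) r)) := by
    have h1 : theta (trialProfile R ψ ε) =ᶠ[𝓝 r] fun t => t ^ (ε / 2) *
        (ε / 2 * scaledCutoff R ψ ε t + theta (scaledCutoff R ψ ε) t) := by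
      filter_upwards [lt_mem_nhds hr0] with t ht using e1 t ht
    have hd0 : DifferentiableAt ℝ (scaledCutoff R ψ ε) r :=
      (hs.differentiable (by simp)).differentiableAt
    have hd1 : DifferentiableAt ℝ (theta (scaledCutoff R ψ ε)) r :=
      (hs1.differentiable (by simp)).differentiableAt
    rw [(theta_congr h1).eq_of_nhds, theta_rpow_mul (ε / 2) hr0 ((hd0.const_mul _).fun_add hd1)]
    congr 2
    rw [theta, deriv_fun_add (hd0.const_mul _) hd1, deriv_const_mul _ hd0]
    simp only [theta]
    ring
  rw [e1 r hr0, e2, trialProfile]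
  have hp0 : 0 ≤ (r ^ (ε / 2)) ^ 2 := sq_nonneg _
  generalize hq : scaledCutoff R ψ ε r = q
  have hb := theta_scaledCutoff_bound hψ hR hD hε hε1 r
  generalize theta (theta (scaledCutoff R ψ ε)) r = y at *
  generalize theta (scaledCutoff R ψ ε) r = x at *
  simp only [mul_pow]
  rcases hb with ⟨rfl, rfl⟩ | ⟨hrS, hx, hy⟩
  · have hq := trial_derivative_sq_le (D := 0) hε hε1 q (x := 0) (y := 0) (by simp) (by simp)
    have h1 := mul_le_mul_of_nonneg_left hq.1 hp0
    have h2 := mul_le_mul_of_nonneg_left hq.2 hp0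
    constructor <;> linarith
  · have hS1 : 1 ≤ S := by
      rcases hrS with h | h
      · rw [hS, Set.indicator_of_mem h]; simpa using hi _ _
      · rw [hS, Set.indicator_of_mem h]; simpa using hi _ _
    have hrR : r ≤ R := by
      rcases hrS with h | h
      · nlinarith [h.2]
      · exact h.2
    have hp : (r ^ (ε / 2)) ^ 2 ≤ 1 + R := by
      have h1 : (r ^ (ε / 2)) ^ 2 = r ^ ε := by
        rw [← Real.rpow_natCast, ← Real.rpow_mul hr0.le]; norm_num
      rw [h1]
      calc r ^ ε ≤ (1 + R) ^ ε := Real.rpow_le_rpow hr0.le (by linarith) hε.le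
        _ ≤ (1 + R) ^ (1 : ℝ) := Real.rpow_le_rpow_of_exponent_le (by linarith) hε1.le
        _ = 1 + R := Real.rpow_one _
    have hx2 : x ^ 2 ≤ D ^ 2 := by rw [← sq_abs x]; gcongr
    have hy2 : y ^ 2 ≤ D ^ 2 := by rw [← sq_abs y]; gcongr
    have hpD : (r ^ (ε / 2)) ^ 2 * D ^ 2 ≤ (1 + R) * D ^ 2 * S := by
      calc (r ^ (ε / 2)) ^ 2 * D ^ 2 ≤ (1 + R) * D ^ 2 := by gcongr
        _ ≤ _ := le_mul_of_one_le_right (by positivity) hS1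
    generalize (r ^ (ε / 2)) ^ 2 = p at *
    have hq := trial_derivative_sq_le hε hε1 q hx2 hy2
    have h1 := mul_le_mul_of_nonneg_left hq.1 hp0
    have h2 := mul_le_mul_of_nonneg_left hq.2 hp0
    constructor <;> linarith

/-- The mass of the trial functions diverges logarithmically as `ε → 0`. -/
lemma tendsto_ip_trialProfile (hφ : IsSphericalEigenfunction μ φ) (hψ : IsCutoff R ψ)
    (hR : 0 < R) :
    Tendsto (fun ε => ip (sepFun φ (trialProfile R ψ ε)) (sepFun φ (trialProfile R ψ ε)))
      (𝓝[>] 0) atTop := by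
  have hm := shellMass_pos hφ (a := 1 / 2 * (R / 5)) (b := R / 5) (by positivity) (by linarith)
  refine tendsto_atTop.2 fun M => ?_
  obtain ⟨K, hK⟩ := exists_nat_gt (2 * M / shellMass φ (1 / 2 * (R / 5)) (R / 5))
  have hc : 0 < (1 / 2 : ℝ) ^ K * (R / 5) := by positivity
  set c := min ((1 / 2 : ℝ) ^ K * (R / 5)) 1 with hcdef
  have hc0 : 0 < c := lt_min hc one_pos
  -- on the shell `2^(-K) R / 5 < r ≤ R / 5` the weight `r^ε` is at least `c^ε`, which tends to `1`
  have h1 : ∀ᶠ ε in 𝓝[>] (0 : ℝ), 1 / 2 ≤ c ^ ε := by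
    have : Tendsto (fun ε : ℝ => c ^ ε) (𝓝[>] 0) (𝓝 1) := by
      have := (Real.continuous_const_rpow hc0.ne').tendsto 0
      rw [Real.rpow_zero] at this
      exact this.mono_left nhdsWithin_le_nhds
    exact (this.eventually (lt_mem_nhds (by norm_num : (1 / 2 : ℝ) < 1))).mono fun _ h => h.le
  have h2 : ∀ᶠ ε in 𝓝[>] (0 : ℝ), ε < (1 / 2 : ℝ) ^ K :=
    nhdsWithin_le_nhds (gt_mem_nhds (by positivity))
  have h3 : ∀ᶠ ε in 𝓝[>] (0 : ℝ), ε < 1 := nhdsWithin_le_nhds (gt_mem_nhds one_pos)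
  filter_upwards [h1, h2, h3, self_mem_nhdsWithin] with ε h1 h2 h3 (hε : 0 < ε)
  have hG := isProfile_trialProfile hψ hR hε h3
  have hle := mul_shellMass_le_ip hφ hG (κ := 1 / 2) (b := R / 5) hc fun r hr => by
    have hr1 : (1 / 2 : ℝ) ^ K * (R / 5) < r := hr.1
    have hr0 : 0 < r := hc.trans hr1
    have hr2 : r ≤ R / 5 := hr.2
    have hεr : ε * R / 5 < r := by nlinarith
    have hsc : scaledCutoff R ψ ε r = 1 := by
      rw [scaledCutoff, if_neg (by linarith), if_pos (by linarith)]
    rw [trialProfile, hsc, mul_one, ← Real.rpow_natCast, ← Real.rpow_mul hr0.le]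
    have : ε / 2 * (2 : ℕ) = ε := by push_cast; ring
    rw [this]
    exact h1.trans (Real.rpow_le_rpow hc0.le ((min_le_left _ _).trans hr1.le) hε.le)
  rw [shellMass_two_pow hφ (by positivity)] at hle
  rw [div_lt_iff₀ hm] at hK
  linarith

/-- The energy quotient of the trial functions. -/
lemma tendsto_trial_quotient (hφ : IsSphericalEigenfunction μ φ) (hψ : IsCutoff R ψ) (hR : 0 < R)
    {a b : ℝ} (ha : a = (4 - n - γ) / 2) (hb : b = (n - γ) / 2) (hpos : 0 < a ^ 2 + μ) :
    (∀ᶠ ε in 𝓝[>] (0 : ℝ),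
      IsTestFunction (Metric.ball 0 R \ {0}) (trialFunction γ R ψ φ ε) ∧
      0 < gradEnergy γ (Metric.ball 0 R) (trialFunction γ R ψ φ ε)) ∧
    Tendsto (fun ε : ℝ => laplaceEnergy γ (Metric.ball 0 R) (trialFunction γ R ψ φ ε) /
        gradEnergy γ (Metric.ball 0 R) (trialFunction γ R ψ φ ε))
      (𝓝[>] 0) (𝓝 ((μ - a * b) ^ 2 / (a ^ 2 + μ))) := by
  obtain ⟨D, hD⟩ := exists_theta_bound hψ hR
  let N : (ℝ → ℝ) → ℝ := fun G => ip (sepFun φ G) (sepFun φ G)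
  have hN0 : ∀ G, 0 ≤ N G := fun G => ip_self_nonneg _
  have hNt := tendsto_ip_trialProfile hφ hψ hR
  have h1 : ∀ᶠ ε in 𝓝[>] (0 : ℝ), ε < 1 := nhdsWithin_le_nhds (gt_mem_nhds one_pos)
  have hNpos : ∀ᶠ ε in 𝓝[>] (0 : ℝ), 0 < N (trialProfile R ψ ε) := hNt.eventually_gt_atTop 0
  set C := 8 * (1 + R) * D ^ 2 * (shellMass φ (R / 20) (R / 5) + shellMass φ (R / 5) R) with hC
  have hbound : ∀ᶠ ε in 𝓝[>] (0 : ℝ),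
      N (theta (trialProfile R ψ ε)) ≤ ε * N (trialProfile R ψ ε) + C ∧
      N (theta (theta (trialProfile R ψ ε))) ≤ ε * N (trialProfile R ψ ε) + C := by
    filter_upwards [h1, self_mem_nhdsWithin] with ε h1 (hε : 0 < ε)
    have hG := isProfile_trialProfile hψ hR hε h1
    have hp := theta_trialProfile_sq_le hψ hR hD hε h1
    have hε20 : 0 < ε * (R / 20) := by positivity
    have hR5 : 0 < R / 5 := by positivity
    rw [hC, ← shellMass_scale φ hε]
    exact ⟨ip_sepFun_le hφ hG hG.theta hε20 hR5 fun r => (hp r).1,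
      ip_sepFun_le hφ hG hG.theta.theta hε20 hR5 fun r => (hp r).2⟩
  have hlim : Tendsto (fun ε => ε + C / N (trialProfile R ψ ε)) (𝓝[>] (0 : ℝ)) (𝓝 0) := by
    have := (tendsto_id.mono_left nhdsWithin_le_nhds : Tendsto id (𝓝[>] (0 : ℝ)) (𝓝 0)).add
      (hNt.const_div_atTop C)
    simpa using this
  have hq1 : Tendsto (fun ε => N (theta (trialProfile R ψ ε)) / N (trialProfile R ψ ε))
      (𝓝[>] (0 : ℝ)) (𝓝 0) := by
    refine squeeze_zero' (.of_forall fun ε => div_nonneg (hN0 _) (hN0 _)) ?_ hlim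
    filter_upwards [hbound, hNpos] with ε hb hN
    rw [div_le_iff₀ hN, add_mul, div_mul_cancel₀ _ hN.ne']
    exact hb.1
  have hq2 : Tendsto (fun ε => N (theta (theta (trialProfile R ψ ε))) / N (trialProfile R ψ ε))
      (𝓝[>] (0 : ℝ)) (𝓝 0) := by
    refine squeeze_zero' (.of_forall fun ε => div_nonneg (hN0 _) (hN0 _)) ?_ hlim
    filter_upwards [hbound, hNpos] with ε hb hN
    rw [div_le_iff₀ hN, add_mul, div_mul_cancel₀ _ hN.ne']
    exact hb.2
  have h0 : (0 : Euc n) ∉ Metric.ball (0 : Euc n) R \ {0} := by simp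
  constructor
  · filter_upwards [h1, hNpos, self_mem_nhdsWithin] with ε h1 hN (hε : 0 < ε)
    have hG := isProfile_trialProfile hψ hR hε h1
    rw [trialFunction_eq hψ hR hε, (energies_sepFun hφ hG ha hb).2]
    exact ⟨(isTestFunction_sepFun hφ hG).powMul h0 _,
      add_pos_of_nonneg_of_pos (hN0 _) (mul_pos hpos hN)⟩
  · have hnum := (hq2.add (hq1.const_mul (a ^ 2 + b ^ 2 + 2 * μ))).add_const ((μ - a * b) ^ 2)
    have hden := hq1.add_const (a ^ 2 + μ)
    have := hnum.div hden (by simpa using hpos.ne')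
    simp only [mul_zero, add_zero, zero_add] at this
    refine this.congr' ?_
    filter_upwards [h1, hNpos, self_mem_nhdsWithin] with ε h1 hN (hε : 0 < ε)
    have hG := isProfile_trialProfile hψ hR hε h1
    rw [trialFunction_eq hψ hR hε, (energies_sepFun hφ hG ha hb).1,
      (energies_sepFun hφ hG ha hb).2]
    simp only [Pi.div_apply]
    refine Eq.trans ?_ (div_div_div_cancel_right₀ hN.ne' _ _)
    simp only [N] at hN ⊢
    congr 1 <;> field_simp

end Trial

/-! ### Existence of cutoffs and of spherical eigenfunctions -/

section Existence

lemma exists_isCutoff {R : ℝ} (hR : 0 < R) : ∃ ψ, IsCutoff R ψ := by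
  refine ⟨fun r => Real.smoothTransition ((r - R / 10) / (R / 10)) *
    Real.smoothTransition ((9 * R / 10 - r) / (R / 10)), ?_, ?_, ?_, ?_⟩
  · exact (Real.smoothTransition.contDiff.comp
      ((contDiff_id.sub contDiff_const).div_const _)).mul
      (Real.smoothTransition.contDiff.comp ((contDiff_const.sub contDiff_id).div_const _))
  · intro r hr
    rw [Real.smoothTransition.zero_of_nonpos
      (div_nonpos_of_nonpos_of_nonneg (by linarith) (by linarith)), zero_mul]
  · intro r hr
    rw [Real.smoothTransition.one_of_one_le, Real.smoothTransition.one_of_one_le, one_mul]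
    · rw [le_div_iff₀ (by linarith)]; linarith [hr.2]
    · rw [le_div_iff₀ (by linarith)]; linarith [hr.1]
  · intro r hr
    rw [Real.smoothTransition.zero_of_nonpos (x := (9 * R / 10 - r) / (R / 10))
      (div_nonpos_of_nonpos_of_nonneg (by linarith) (by linarith)), mul_zero]

/-- A power of a null linear form is harmonic. -/
lemma laplacian_pow_eq_zero (ℓ : Euc n →L[ℝ] ℂ)
    (hℓ : ∑ i, ℓ (EuclideanSpace.single i 1) ^ 2 = 0) (j : ℕ) (x : Euc n) :
    Laplacian.laplacian (fun x => ℓ x ^ j) x = 0 := by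
  have h1 : ∀ (m : ℕ) (y v : Euc n), fderiv ℝ (fun x => ℓ x ^ m) y v =
      m * ℓ y ^ (m - 1) * ℓ v := fun m y v => by
    rw [(ℓ.hasFDerivAt.pow m).fderiv]
    simp
  have hs : ContDiff ℝ ∞ (fun x => ℓ x ^ j) := ℓ.contDiff.pow j
  have h2 : ∀ v : Euc n, fderiv ℝ (fderiv ℝ (fun x => ℓ x ^ j)) x v v =
      (j * ((j - 1 : ℕ) * ℓ x ^ (j - 1 - 1))) * ℓ v ^ 2 := fun v => by
    have hd : DifferentiableAt ℝ (fderiv ℝ (fun x => ℓ x ^ j)) x :=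
      ((hs.fderiv_right (m := 1) (by norm_cast)).differentiable
        (by simp)).differentiableAt
    have h3 : fderiv ℝ (fun y => fderiv ℝ (fun x => ℓ x ^ j) y v) x v =
        fderiv ℝ (fderiv ℝ (fun x => ℓ x ^ j)) x v v := by
      rw [(hd.hasFDerivAt.clm_apply (hasFDerivAt_const v x)).fderiv]
      simp
    rw [← h3]
    have h4 : (fun y => fderiv ℝ (fun x => ℓ x ^ j) y v) =
        fun y => ((j : ℂ) * ℓ v) • ℓ y ^ (j - 1) := by
      ext y
      rw [h1, smul_eq_mul]; ring
    rw [h4, fderiv_fun_const_smul (ℓ.differentiableAt.fun_pow _), smul_apply, h1, smul_eq_mul]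
    ring
  rw [laplacian_eq_sum_fderiv]
  simp only [h2, ← Finset.mul_sum, hℓ, mul_zero]

lemma exists_isSphericalEigenfunction (hn : 2 ≤ n) (j : ℕ) :
    ∃ φ : Euc n → ℂ, IsSphericalEigenfunction (eigval n j) φ := by
  let i₀ : Fin n := ⟨0, by omega⟩
  let i₁ : Fin n := ⟨1, by omega⟩
  have hne : i₀ ≠ i₁ := by simp [i₀, i₁]
  -- the null linear form `x₀ + i x₁`, whose powers are harmonic
  let ℓ : Euc n →L[ℝ] ℂ := Complex.ofRealCLM.comp (EuclideanSpace.proj (𝕜 := ℝ) i₀) +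
    Complex.I • Complex.ofRealCLM.comp (EuclideanSpace.proj (𝕜 := ℝ) i₁)
  have hℓa : ∀ x, ℓ x = (x i₀ : ℂ) + Complex.I * (x i₁ : ℂ) := fun x => by simp [ℓ]
  have hℓ : ∑ i, ℓ (EuclideanSpace.single i 1) ^ 2 = 0 := by
    rw [Finset.sum_eq_add i₀ i₁ hne]
    · simp [hℓa, hne, hne.symm]
    · intro i _ hi
      simp [hℓa, hi.1.symm, hi.2.symm]
    · simp
    · simp
  have hh : IsHomog j (fun x => ℓ x ^ j) := ⟨ℓ.contDiff.pow j, fun t ht x => by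
    simp [mul_pow]⟩
  have hL : ∀ x, sphLap (fun x => ℓ x ^ j) x = eigval n j • ℓ x ^ j := fun x => by
    rw [hh.sphLap_eq, laplacian_pow_eq_zero ℓ hℓ, smul_zero, sub_zero]
  have hext : rayExt (fun x => ℓ x ^ j) = fun x => (‖x‖ ^ (-(j : ℝ))) • ℓ x ^ j := by
    ext x
    rw [rayExt, map_smul, smul_pow, Real.rpow_neg (norm_nonneg x), Real.rpow_natCast, inv_pow]
  have hs : ContDiffOn ℝ ∞ (rayExt fun x => ℓ x ^ j) {0}ᶜ := by
    rw [hext]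
    exact fun x hx => ((contDiffAt_norm_rpow _ hx).smul
      hh.contDiff.contDiffAt).contDiffWithinAt
  refine ⟨fun x => ℓ x ^ j, hs, fun x hx => ?_, EuclideanSpace.single i₀ 1, by simp, ?_⟩
  · have hx0 : x ≠ 0 := fun h => by simp [h] at hx
    have h1 := norm_sq_smul_laplacian_rayExt hs hx0
    rw [hx, one_pow, one_smul] at h1
    have hr := isRadialAt_comp_norm hx0 (contDiffAt_rpow_of_pos (-(j : ℝ))
      (norm_pos_iff.2 hx0))
    have h2 := sphLap_radial_smul hr (f := fun x => ℓ x ^ j) hh.contDiff.contDiffAt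
    rw [hL, hx, Real.one_rpow, one_smul] at h2
    rw [h1, neg_neg, hext, h2, Complex.real_smul]
  · simp [hℓa, hne.symm]

end Existence

/-! ### The optimal constant -/

section Constant

variable {γ a b : ℝ}

lemma alphaCoeff_zero (hb : b = (n - γ) / 2) : alphaCoeff n γ 0 = b ^ 2 := by
  simp only [alphaCoeff, if_true, hb]; ring

lemma alphaCoeff_of_ne_zero (ha : a = (4 - n - γ) / 2) (hb : b = (n - γ) / 2) {j : ℕ}
    (hj : j ≠ 0) : alphaCoeff n γ j = (eigval n j - a * b) ^ 2 / (a ^ 2 + eigval n j) := by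
  rw [alphaCoeff, if_neg hj, ha, hb]
  congr 1 <;> ring

lemma natCast_le_eigval (hn : 2 ≤ n) (j : ℕ) : (j : ℝ) ≤ eigval n j := by
  have h1 : (2 : ℝ) ≤ n := by exact_mod_cast hn
  rcases Nat.eq_zero_or_pos j with rfl | hj
  · simp [eigval]
  · have h2 : (1 : ℝ) ≤ j := by exact_mod_cast hj
    rw [eigval]
    nlinarith

lemma eigval_pos (hn : 2 ≤ n) {j : ℕ} (hj : j ≠ 0) : 0 < eigval n j :=
  lt_of_lt_of_le (by positivity) (natCast_le_eigval hn j)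

lemma isLeast_constA (hn : 2 ≤ n) (γ : ℝ) :
    IsLeast (Set.range (alphaCoeff n γ)) (constA n γ) := by
  obtain ⟨a, ha⟩ : ∃ a : ℝ, a = (4 - n - γ) / 2 := ⟨_, rfl⟩
  obtain ⟨b, hb⟩ : ∃ b : ℝ, b = (n - γ) / 2 := ⟨_, rfl⟩
  -- the difference is the square `(a b + a²)²` over the positive denominator
  have hlow : ∀ j : ℕ, j ≠ 0 → (j : ℝ) - (2 * a * b + a ^ 2) ≤ alphaCoeff n γ j := fun j hj => by
    have hp := eigval_pos hn hj
    rw [alphaCoeff_of_ne_zero ha hb hj, le_div_iff₀ (by positivity)]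
    have h1 := mul_le_mul_of_nonneg_right (natCast_le_eigval hn j)
      (show 0 ≤ a ^ 2 + eigval n j by positivity)
    nlinarith [sq_nonneg (a * b + a ^ 2)]
  have hlim : Tendsto (alphaCoeff n γ) cofinite atTop := by
    rw [Nat.cofinite_eq_atTop]
    refine tendsto_atTop_mono' _ ?_
      (tendsto_atTop_add_const_right _ (-(2 * a * b + a ^ 2)) tendsto_natCast_atTop_atTop)
    filter_upwards [eventually_ne_atTop 0] with j hj using hlow j hj
  obtain ⟨j₀, hj₀⟩ := hlim.exists_forall_le
  have h : IsLeast (Set.range (alphaCoeff n γ)) (alphaCoeff n γ j₀) :=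
    ⟨⟨j₀, rfl⟩, by rintro _ ⟨j, rfl⟩; exact hj₀ j⟩
  have hA : constA n γ = alphaCoeff n γ j₀ := h.csInf_eq
  rwa [hA]

/-- At a minimizing index the denominator of the quotient does not degenerate. This is where the
two exceptional pairs `(n, γ)` are excluded. -/
lemma sq_add_eigval_pos (hn : 2 ≤ n) (h₁ : ¬(n = 2 ∧ γ = 2)) (h₂ : ¬(n = 3 ∧ γ = 1))
    (ha : a = (4 - n - γ) / 2) {j : ℕ} (hj : alphaCoeff n γ j = constA n γ) :
    0 < a ^ 2 + eigval n j := by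
  by_cases hj0 : j = 0
  · subst hj0
    have h0 : eigval n 0 = 0 := by simp [eigval]
    rw [h0, add_zero]
    refine sq_pos_of_ne_zero fun ha0 => ?_
    have hγ : γ = 4 - n := by linarith
    have hle : alphaCoeff n γ 0 ≤ alphaCoeff n γ 1 := hj ▸ (isLeast_constA hn γ).2 ⟨1, rfl⟩
    rw [alphaCoeff_zero rfl, alphaCoeff_of_ne_zero rfl rfl one_ne_zero] at hle
    -- for `a = 0` minimality of `j = 0` says `(n - 2)² ≤ n - 1`, that is `n ≤ 3`
    have h1 : eigval n 1 = n - 1 := by simp only [eigval]; push_cast; ring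
    have h2 : (2 : ℝ) ≤ n := by exact_mod_cast hn
    rw [h1, ← ha, ha0, hγ, zero_mul, sub_zero, zero_pow two_ne_zero, zero_add, sq (_ - 1 : ℝ),
      mul_div_assoc, div_self (by linarith), mul_one] at hle
    have h3 : n < 4 := by
      by_contra h
      have : (4 : ℝ) ≤ n := by exact_mod_cast not_lt.1 h
      nlinarith
    interval_cases n
    · exact h₁ ⟨rfl, by rw [hγ]; norm_num⟩
    · exact h₂ ⟨rfl, by rw [hγ]; norm_num⟩
  · have := eigval_pos hn hj0
    positivity

lemma alphaCoeff_eq_div (ha : a = (4 - n - γ) / 2) (hb : b = (n - γ) / 2) {j : ℕ}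
    (hpos : 0 < a ^ 2 + eigval n j) :
    alphaCoeff n γ j = (eigval n j - a * b) ^ 2 / (a ^ 2 + eigval n j) := by
  by_cases hj : j = 0
  · subst hj
    have h0 : eigval n 0 = 0 := by simp [eigval]
    rw [h0, add_zero] at hpos
    rw [alphaCoeff_zero hb, h0, eq_div_iff (by simpa using hpos.ne')]
    ring
  · exact alphaCoeff_of_ne_zero ha hb hj

lemma constA_mul_le (hn : 2 ≤ n) (ha : a = (4 - n - γ) / 2) (hb : b = (n - γ) / 2) (j : ℕ) :
    constA n γ * (a ^ 2 + eigval n j) ≤ (eigval n j - a * b) ^ 2 := by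
  have h := (isLeast_constA hn γ).2 ⟨j, rfl⟩
  by_cases hj : j = 0
  · subst hj
    have h0 : eigval n 0 = 0 := by simp [eigval]
    rw [alphaCoeff_zero hb] at h
    rw [h0]
    nlinarith [mul_le_mul_of_nonneg_right h (sq_nonneg a)]
  · have := eigval_pos hn hj
    rwa [alphaCoeff_of_ne_zero ha hb hj, le_div_iff₀ (by positivity)] at h

lemma constA_mem_admissibleConstants (hn : 2 ≤ n) (γ : ℝ) (Ω : Set (Euc n)) :
    constA n γ ∈ admissibleConstants n γ Ω := fun f hf =>
  mul_gradEnergy_le_laplaceEnergy hn rfl rfl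
    ((isLeast_constA hn γ).2 ⟨0, alphaCoeff_zero rfl⟩) (constA_mul_le hn rfl rfl) hf (by simp)
    Set.sdiff_subset

lemma trial_limit (hn : 2 ≤ n) (h₁ : ¬(n = 2 ∧ γ = 2)) (h₂ : ¬(n = 3 ∧ γ = 1)) {R : ℝ}
    (hR : 0 < R) {ψ : ℝ → ℝ} (hψ : IsCutoff R ψ) {j₀ : ℕ}
    (hj : alphaCoeff n γ j₀ = constA n γ) {φ : Euc n → ℂ}
    (hφ : IsSphericalEigenfunction (eigval n j₀) φ) :
    (∀ᶠ ε in 𝓝[>] (0 : ℝ),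
      IsTestFunction (Metric.ball 0 R \ {0}) (trialFunction γ R ψ φ ε) ∧
      0 < gradEnergy γ (Metric.ball 0 R) (trialFunction γ R ψ φ ε)) ∧
    Tendsto (fun ε : ℝ => laplaceEnergy γ (Metric.ball 0 R) (trialFunction γ R ψ φ ε) /
        gradEnergy γ (Metric.ball 0 R) (trialFunction γ R ψ φ ε))
      (𝓝[>] 0) (𝓝 (alphaCoeff n γ j₀)) := by
  have hpos := sq_add_eigval_pos hn h₁ h₂ rfl hj
  rw [alphaCoeff_eq_div rfl rfl hpos]
  exact tendsto_trial_quotient hφ hψ hR rfl rfl hpos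

lemma isGreatest_constA_ball (hn : 2 ≤ n) (h₁ : ¬(n = 2 ∧ γ = 2)) (h₂ : ¬(n = 3 ∧ γ = 1)) {R : ℝ}
    (hR : 0 < R) : IsGreatest (admissibleConstants n γ (Metric.ball 0 R)) (constA n γ) := by
  refine ⟨constA_mem_admissibleConstants hn γ _, fun C hC => ?_⟩
  obtain ⟨j₀, hj⟩ := (isLeast_constA hn γ).1
  obtain ⟨φ, hφ⟩ := exists_isSphericalEigenfunction hn j₀
  obtain ⟨ψ, hψ⟩ := exists_isCutoff hR
  obtain ⟨h1, h2⟩ := trial_limit hn h₁ h₂ hR hψ hj hφ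
  rw [hj] at h2
  refine ge_of_tendsto h2 ?_
  filter_upwards [h1] with ε ⟨ht, hg⟩
  rw [le_div_iff₀ hg]
  exact hC _ ht

lemma energies_ball_eq_univ {R : ℝ} {f : Euc n → ℂ}
    (hf : IsTestFunction (Metric.ball 0 R \ {0}) f) :
    laplaceEnergy γ Set.univ f = laplaceEnergy γ (Metric.ball 0 R) f ∧
      gradEnergy γ Set.univ f = gradEnergy γ (Metric.ball 0 R) f := by
  have h : ∀ x ∉ Metric.ball (0 : Euc n) R, x ∉ tsupport f := fun x hx h => hx (hf.2.2 h).1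
  constructor
  · rw [laplaceEnergy, laplaceEnergy, Measure.restrict_univ]
    refine (setIntegral_eq_integral_of_forall_compl_eq_zero fun x hx => ?_).symm
    have h1 : f =ᶠ[𝓝 x] fun _ => 0 := notMem_tsupport_iff_eventuallyEq.1 (h x hx)
    have h2 : Laplacian.laplacian f x = 0 := by
      rw [(InnerProductSpace.laplacian_congr_nhds h1).eq_of_nhds]
      simp
    simp [h2]
  · rw [gradEnergy, gradEnergy, Measure.restrict_univ]
    refine (setIntegral_eq_integral_of_forall_compl_eq_zero fun x hx => ?_).symm
    simp [gradSq, fderiv_of_notMem_tsupport ℝ (h x hx)]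

/-- Sharpness on a ball implies sharpness on the whole space. -/
lemma isGreatest_constA_univ (hn : 2 ≤ n) (h₁ : ¬(n = 2 ∧ γ = 2)) (h₂ : ¬(n = 3 ∧ γ = 1)) :
    IsGreatest (admissibleConstants n γ Set.univ) (constA n γ) := by
  refine ⟨constA_mem_admissibleConstants hn γ _, fun C hC => ?_⟩
  refine (isGreatest_constA_ball hn h₁ h₂ one_pos).2 fun f hf => ?_
  rw [← (energies_ball_eq_univ hf).1, ← (energies_ball_eq_univ hf).2]
  exact hC f (hf.mono (Set.sdiff_subset_sdiff_left (Set.subset_univ _)))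

end Constant

end HardyRellich

theorem theoremt3 (n : ℕ) (hn : 2 ≤ n) (γ : ℝ)
    (h₁ : ¬ (n = 2 ∧ γ = 2)) (h₂ : ¬ (n = 3 ∧ γ = 1)) :
    IsLeast (Set.range (HardyRellich.alphaCoeff n γ)) (HardyRellich.constA n γ) ∧
    (∀ R : ℝ, 0 < R →
      IsGreatest (HardyRellich.admissibleConstants n γ (Metric.ball 0 R))
        (HardyRellich.constA n γ)) ∧
    IsGreatest (HardyRellich.admissibleConstants n γ Set.univ) (HardyRellich.constA n γ) ∧
    (∀ R : ℝ, 0 < R → ∀ ψ : ℝ → ℝ, HardyRellich.IsCutoff R ψ →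
      ∀ j₀ : ℕ, HardyRellich.alphaCoeff n γ j₀ = HardyRellich.constA n γ →
      ∀ φ : HardyRellich.Euc n → ℂ,
        HardyRellich.IsSphericalEigenfunction (HardyRellich.eigval n j₀) φ →
        (∀ᶠ ε in 𝓝[>] (0 : ℝ),
          HardyRellich.IsTestFunction (Metric.ball 0 R \ {0})
            (HardyRellich.trialFunction γ R ψ φ ε) ∧
          0 < HardyRellich.gradEnergy γ (Metric.ball 0 R)
            (HardyRellich.trialFunction γ R ψ φ ε)) ∧
        Tendsto (fun ε : ℝ =>
            HardyRellich.laplaceEnergy γ (Metric.ball 0 R)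
                (HardyRellich.trialFunction γ R ψ φ ε) /
              HardyRellich.gradEnergy γ (Metric.ball 0 R)
                (HardyRellich.trialFunction γ R ψ φ ε))
          (𝓝[>] 0) (𝓝 (HardyRellich.alphaCoeff n γ j₀))) :=
  ⟨HardyRellich.isLeast_constA hn γ,
    fun _ hR => HardyRellich.isGreatest_constA_ball hn h₁ h₂ hR,
    HardyRellich.isGreatest_constA_univ hn h₁ h₂,
    fun _ hR _ hψ _ hj _ hφ => HardyRellich.trial_limit hn h₁ h₂ hR hψ hj hφ⟩
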